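/- A committee consists of $n$ nonexperts and $E$ experts, with $n$ even and $E$ odd; let $N=n+E$. The state $\omega\in\{a,b\}$ has prior probability $\tfrac12$ each. Conditionally on $\omega$ the voters' signals $s_i\in\{a,b\}$ are independent, and $s_i=\omega$ with probability $q_i$, where $q_i=q\in(\tfrac12,1)$ for every nonexpert and $q_i\in(q,1)$ for every expert $i$. All voters are independents: each gets payoff $1$ if the elected alternative matches the state and $0$ otherwise. For an expert $i$ let $$w^*(i)=\frac{\log\frac{q_i}{1-q_i}}{\log\frac{q}{1-q}}.$$ In liquid democracy (LD) a strategy of voter $i$ is a map $\sigma_i$ from her signal to one of the actions: vote for $A$ (written $a$), vote for $B$ (written $b$), abstain ($x$), or delegate to a voter $j\ne i$ ($d_j$). Delegation is transitive, and votes that end in a delegation cycle count as abstentions. In direct democracy (DD) delegation is not available. The alternative with more votes cast is elected, ties being broken uniformly at random. An equilibrium is a pure-strategy Bayes Nash equilibrium in which no voter uses a weakly dominated strategy. A profile is neutral if every voter votes sincerely ($\sigma_i(a)=a$, $\sigma_i(b)=b$), abstains at both signals, or delegates to the same voter at both signals. A best neutral equilibrium of a voting system is a neutral equilibrium whose expected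 utility (the probability of electing the correct alternative) is the greatest among all neutral equilibria of that system. **Proposition.** Fix $q$, $E$ and the experts' precisions. There is $\bar n$ such that for all even $n\ge\bar n$: (i) If $E=1$ or no $w^*(i)$ is an integer, there is a best neutral equilibrium $\sigma$ of LD in which 1. for each expert $i$, exactly $\lfloor w^*(i)\rfloor-1$ nonexperts $j$ delegate to her at both signals ($\sigma_j(a)=\sigma_j(b)=d_i$); 2. all other voters, in particular all experts, vote sincerely. (ii) If $w^*(i)>2$ for some expert $i$, then LD and DD both have best neutral equilibria, and a best neutral equilibrium of LD has strictly greater expected utility than a best neutral equilibrium of DD. -/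

import Mathlib

namespace LiquidDemocracy

/-! States, signals and alternatives are all encoded by `Bool`: `true` stands for the state `a`,
the signal `a` and the alternative `A`, and `false` for `b`, `b` and `B`. Alternative `ω` is the
correct one in state `ω`. The voters are the elements of a finite type `ι`. -/

/-- What a voter can do: vote for an alternative, abstain, or delegate to a voter. -/
inductive Action (ι : Type) : Type where
  | vote (x : Bool) : Action ι
  | abstain : Action ι
  | delegate (j : ι) : Action ι

/-- The two voting systems: liquid democracy and direct democracy. -/
inductive Mechanism : Type where
  | liquid : Mechanism
  | direct : Mechanism

/-- The actions available to voter `i`: under liquid democracy everything except delegating to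
herself, under direct democracy everything except delegating. -/
def Mechanism.Allows {ι : Type} : Mechanism → ι → Action ι → Prop
  | .liquid, i, x => x ≠ .delegate i
  | .direct, _, x => ∀ j, x ≠ .delegate j

/-- A pure interim strategy of a voter: an action for each realization of her signal. -/
abbrev Strategy (ι : Type) : Type := Bool → Action ι

/-- A strategy profile. -/
abbrev Profile (ι : Type) : Type := ι → Strategy ι

/-- `CastFor α i x`: when the voters take the actions `α`, the vote that voter `i` was endowed with
is cast for alternative `x`. Delegation is transitive. A vote that reaches an abstainer or a
delegation cycle is cast for neither alternative. -/
inductive CastFor {ι : Type} (α : ι → Action ι) : ι → Bool → Prop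
  | vote {i : ι} {x : Bool} (h : α i = .vote x) : CastFor α i x
  | delegate {i j : ι} {x : Bool} (h : α i = .delegate j) (hj : CastFor α j x) : CastFor α i x

open Classical in
/-- The number of votes cast for alternative `x`. -/
noncomputable def tally {ι : Type} [Fintype ι] (α : ι → Action ι) (x : Bool) : ℕ :=
  (Finset.univ.filter fun i => CastFor α i x).card

/-- The probability that alternative `x` is elected by simple majority of the votes cast, ties
being broken uniformly at random. -/
noncomputable def winProb {ι : Type} [Fintype ι] (α : ι → Action ι) (x : Bool) : ℝ :=
  if tally α (!x) < tally α x then 1 else if tally α x = tally α (!x) then 1 / 2 else 0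

/-- The probability of the signal realization `s` in state `ω`: conditionally on the state, the
signals are independent and that of voter `i` is correct with probability `p i`. -/
noncomputable def signalProb {ι : Type} [Fintype ι] (p : ι → ℝ) (ω : Bool) (s : ι → Bool) : ℝ :=
  ∏ i, if s i = ω then p i else 1 - p i

/-- The expected utility of a profile, with prior `1 / 2` on each state. All voters are
independents, with payoff `1` if the elected alternative matches the state and `0` otherwise, so
that they share this utility, which is the probability of the correct outcome. -/
noncomputable def utility {ι : Type} [Fintype ι] [DecidableEq ι] (p : ι → ℝ)
    (σ : Profile ι) : ℝ :=
  ∑ ω : Bool, (1 / 2) * ∑ s : ι → Bool, signalProb p ω s * winProb (fun i => σ i (s i)) ω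

/-- The strategy `τ` is feasible for voter `i`. -/
def FeasibleStrategy {ι : Type} (M : Mechanism) (i : ι) (τ : Strategy ι) : Prop :=
  ∀ s, M.Allows i (τ s)

/-- All voters use feasible strategies. -/
def Feasible {ι : Type} (M : Mechanism) (σ : Profile ι) : Prop :=
  ∀ i, FeasibleStrategy M i (σ i)

/-- The strategy `τ` of voter `i` is weakly dominated by a (possibly mixed) strategy, the one that
plays each `ρ ∈ F` with probability `c ρ`. -/
def WeaklyDominated {ι : Type} [Fintype ι] [DecidableEq ι] (M : Mechanism) (p : ι → ℝ) (i : ι)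
    (τ : Strategy ι) : Prop :=
  ∃ (F : Finset (Strategy ι)) (c : Strategy ι → ℝ),
    (∀ ρ ∈ F, FeasibleStrategy M i ρ ∧ 0 ≤ c ρ) ∧ ∑ ρ ∈ F, c ρ = 1 ∧
    (∀ σ : Profile ι, Feasible M σ →
      utility p (Function.update σ i τ) ≤ ∑ ρ ∈ F, c ρ * utility p (Function.update σ i ρ)) ∧
    (∃ σ : Profile ι, Feasible M σ ∧
      utility p (Function.update σ i τ) < ∑ ρ ∈ F, c ρ * utility p (Function.update σ i ρ))

/-- A Bayes Nash equilibrium in which no voter uses a weakly dominated strategy. Deviations are to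
arbitrary feasible strategies. -/
def IsEquilibrium {ι : Type} [Fintype ι] [DecidableEq ι] (M : Mechanism) (p : ι → ℝ)
    (σ : Profile ι) : Prop :=
  Feasible M σ ∧
  (∀ i, ∀ τ : Strategy ι, FeasibleStrategy M i τ →
    utility p (Function.update σ i τ) ≤ utility p σ) ∧
  (∀ i, ¬ WeaklyDominated M p i (σ i))

/-- Sincere voting: vote according to one's signal. -/
def Sincere {ι : Type} (τ : Strategy ι) : Prop := ∀ s, τ s = .vote s

/-- Delegation to voter `j` at both signal realizations. -/
def DelegatesTo {ι : Type} (τ : Strategy ι) (j : ι) : Prop := ∀ s, τ s = .delegate j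

/-- A neutral profile: every voter votes sincerely, abstains at both signal realizations, or
delegates to the same voter at both signal realizations. -/
def Neutral {ι : Type} (σ : Profile ι) : Prop :=
  ∀ i, Sincere (σ i) ∨ (∀ s, σ i s = .abstain) ∨ ∃ j, DelegatesTo (σ i) j

/-- A best neutral equilibrium: a neutral equilibrium with the greatest expected utility among all
neutral equilibria of the voting system. -/
def IsBestNeutralEquilibrium {ι : Type} [Fintype ι] [DecidableEq ι] (M : Mechanism) (p : ι → ℝ)
    (σ : Profile ι) : Prop :=
  IsEquilibrium M p σ ∧ Neutral σ ∧
  ∀ τ : Profile ι, IsEquilibrium M p τ → Neutral τ → utility p τ ≤ utility p σ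

/-- The committee of `n` nonexperts (`Sum.inl`) of precision `q` and `E` experts (`Sum.inr`) of
precisions `r`. -/
def committee (n E : ℕ) (q : ℝ) (r : Fin E → ℝ) : Fin n ⊕ Fin E → ℝ :=
  Sum.elim (fun _ => q) r

/-- The optimal weight `w*` of a voter of precision `r` relative to nonexperts of precision `q`. -/
noncomputable def optimalWeight (q r : ℝ) : ℝ :=
  Real.log (r / (1 - r)) / Real.log (q / (1 - q))

end LiquidDemocracy

open LiquidDemocracy

/-! Write q/(1-q) = ν² and c = (ν+ν⁻¹)/2. A neutral profile matters only through the number w_k of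
votes that each sincere voter k ends up casting: its utility is 1 - `lossProb p w`
(`utility_eq_one_sub_lossProb`), so the game reduces to comparing weight vectors of total at most
n+E.

Exponential tilting by ν gives the size of the loss. If m nonexperts cast exactly one vote and the
remaining votes are bounded in number, the loss is, up to a factor tending to 1, `centralProb m` ·
(ν-ν⁻¹)⁻¹ · ∏ E[ν^(-signed vote of k)]. The upper bound needs an odd number of votes cast
(`lossProb_le`); the lower bound does not (`exists_lossProb_ge`). Multiplied by c^(n+E), the product
becomes c^(votes not cast) · ∏ `voterLoss`. Passing from w to w+1 votes changes `voterLoss` with the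
sign of (1-p)ν^(2(w+1)) - p, that is, of w+1-w*. Hence an expert's factor is least at ⌊w*⌋, and also
at ⌊w*⌋-1 exactly when w* is an integer. A nonexpert's factor is 1 at zero or one vote and at least
c > 1 beyond. So for large n every weight vector that is not `LimitOptimal` loses strictly to the
proposed profile (`exists_lossProb_lt`). Profiles with many inactive nonexperts lie outside the
sharp estimate, but a crude bound already shows them to be exponentially worse
(`lossProb_ge_of_active`).

Limit-optimal vectors must be compared exactly. Without integer w* the expert weights coincide; for
a single expert with integer w* the two candidates have equal loss (`lossFun_tie`). This is where
the assumption of (i) enters.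

For equilibria: the voters share one payoff, so a maximizer among feasible neutral profiles survives
all neutral deviations, and symmetry between the alternatives reduces arbitrary deviations to
neutral ones (`utility_update_le`). Domination is excluded by exhibiting profiles to which the
strategy is the unique best reply. For (ii), direct democracy caps weights at one, whereas an expert
with w* > 2 needs at least two votes. -/

namespace LiquidDemocracy

/-! ### Loss as a function of the lead, and central binomial probabilities -/

/-- The probability of the wrong outcome when the correct alternative leads by `y` votes. -/
noncomputable def lossAt (y : ℤ) : ℝ := if y < 0 then 1 else if y = 0 then 1 / 2 else 0

lemma lossAt_nonneg (y : ℤ) : 0 ≤ lossAt y := by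
  unfold lossAt; split_ifs <;> norm_num

lemma lossAt_add_neg (y : ℤ) : lossAt y + lossAt (-y) = 1 := by
  unfold lossAt
  rcases lt_trichotomy y 0 with h | h | h
  · simp [h, h.ne, h.le]
  · subst h; norm_num
  · simp [h, h.ne', h.le]

lemma lossAt_of_neg {y : ℤ} (h : y < 0) : lossAt y = 1 := by simp [lossAt, h]

lemma lossAt_of_pos {y : ℤ} (h : 0 < y) : lossAt y = 0 := by
  simp [lossAt, not_lt.2 h.le, h.ne']

/-- The central binomial probability of `m` fair coins. -/
noncomputable def centralProb (m : ℕ) : ℝ := (m.choose (m / 2) : ℝ) / 2 ^ m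

lemma centralProb_pos (m : ℕ) : 0 < centralProb m := by
  unfold centralProb
  have : 0 < m.choose (m / 2) := Nat.choose_pos (Nat.div_le_self m 2)
  positivity

lemma choose_succ_middle_le (m : ℕ) :
    (m + 1).choose ((m + 1) / 2) ≤ 2 * m.choose (m / 2) := by
  cases h : (m + 1) / 2 with
  | zero =>
    have := Nat.choose_pos (Nat.div_le_self m 2)
    simp; omega
  | succ k =>
    rw [Nat.choose_succ_succ']
    have h1 := Nat.choose_le_middle k m
    have h2 := Nat.choose_le_middle (k + 1) m
    omega

lemma centralProb_succ_le (m : ℕ) : centralProb (m + 1) ≤ centralProb m := by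
  unfold centralProb
  rw [div_le_div_iff₀ (by positivity) (by positivity), pow_succ]
  have : (((m + 1).choose ((m + 1) / 2) : ℕ) : ℝ) ≤ 2 * m.choose (m / 2) := by
    exact_mod_cast choose_succ_middle_le m
  have h2 : (0 : ℝ) < 2 ^ m := by positivity
  nlinarith

lemma centralProb_antitone : Antitone centralProb := antitone_nat_of_succ_le centralProb_succ_le

/-- Together with antitonicity this takes the place of Stirling's formula: for 0 < m ≤ n,
`centralProb m` exceeds `centralProb n` by at most the factor n/m, which tends to 1 when n-m stays
bounded. -/
lemma mul_centralProb_le_succ (m : ℕ) :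
    (m : ℝ) * centralProb m ≤ ((m + 1 : ℕ) : ℝ) * centralProb (m + 1) := by
  have h1 : (m + 1) * m.choose (m / 2) = (m + 1).choose (m / 2 + 1) * (m / 2 + 1) :=
    Nat.add_one_mul_choose_eq m (m / 2)
  have h2 := Nat.choose_le_middle (m / 2 + 1) (m + 1)
  have h3 : 2 * (m / 2 + 1) ≤ m + 2 := by omega
  set a := m.choose (m / 2) with ha
  set b := (m + 1).choose ((m + 1) / 2) with hb
  have h4 : 2 * ((m + 1) * a) ≤ b * (m + 2) := by
    rw [h1]
    calc 2 * ((m + 1).choose (m / 2 + 1) * (m / 2 + 1))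
        = (m + 1).choose (m / 2 + 1) * (2 * (m / 2 + 1)) := by ring
      _ ≤ b * (m + 2) := Nat.mul_le_mul h2 h3
  have h5 : 2 * (m * a) ≤ (m + 1) * b := by
    have : (m + 2) * (2 * (m * a)) ≤ (m + 2) * ((m + 1) * b) := by nlinarith
    exact Nat.le_of_mul_le_mul_left this (by omega)
  have h6 : 2 * ((m : ℝ) * a) ≤ (m + 1) * b := by exact_mod_cast h5
  unfold centralProb
  rw [← ha, ← hb, pow_succ, mul_div_assoc', mul_div_assoc',
    div_le_div_iff₀ (by positivity) (by positivity)]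
  have h7 : (0 : ℝ) < 2 ^ m := by positivity
  push_cast
  nlinarith

lemma monotone_mul_centralProb : Monotone fun m : ℕ => (m : ℝ) * centralProb m :=
  monotone_nat_of_le_succ mul_centralProb_le_succ

/-- Binomial coefficients at bounded distance from the middle are comparable to the central one. -/
lemma exists_choose_ge (R : ℕ) {ε : ℝ} (hε : 0 < ε) :
    ∃ M : ℕ, ∀ m ≥ M, ∀ j : ℕ, m ≤ 2 * j + (R + 1) → 2 * j ≤ m + (R + 1) →
      (1 - ε) * m.choose (m / 2) ≤ m.choose j := by
  induction R generalizing ε with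
  | zero =>
    refine ⟨0, fun m _ j h1 h2 => ?_⟩
    have : m.choose (m / 2) = m.choose j := by
      rcases (by omega : j = m / 2 ∨ m = m / 2 + j) with h | h
      · rw [h]
      · exact Nat.choose_symm_of_eq_add h
    rw [this]
    have : (0 : ℝ) ≤ m.choose j := by positivity
    nlinarith
  | succ R ih =>
    by_cases hε1 : 1 ≤ ε
    · refine ⟨0, fun m _ j h1 h2 => ?_⟩
      have h1 : (0 : ℝ) ≤ m.choose j := by positivity
      have h2 : (0 : ℝ) ≤ m.choose (m / 2) := by positivity
      nlinarith
    push Not at hε1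
    obtain ⟨M, hM⟩ := ih (half_pos hε)
    -- A step away from the middle multiplies the coefficient by at least (m-R)/(m+R+2), which is
    -- 1-O(R/m); this threshold makes it at least 1-ε/2, and the induction hypothesis supplies the
    -- other ε/2.
    obtain ⟨M', hM'⟩ := exists_nat_gt ((2 * R + 9) / (ε / 2))
    have hM'2 : (2 * R + 9 : ℝ) < M' * (ε / 2) := by
      rwa [div_lt_iff₀ (by positivity)] at hM'
    refine ⟨max (max M M') (R + 3), fun m hm j h1 h2 => ?_⟩
    have hmM : M ≤ m := le_trans (le_trans (le_max_left _ _) (le_max_left _ _)) hm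
    have hmM' : M' ≤ m := le_trans (le_trans (le_max_right _ _) (le_max_left _ _)) hm
    have hmR : R + 3 ≤ m := le_trans (le_max_right _ _) hm
    have hmr : (2 * R + 9 : ℝ) ≤ m * (ε / 2) := by
      have : (M' : ℝ) ≤ m := by exact_mod_cast hmM'
      nlinarith
    -- a neighbour closer to the middle
    have key : ∀ a b x y : ℝ, 0 ≤ a → 0 < x → b * x = a * y → (1 - ε / 2) * x ≤ y →
        (1 - ε / 2) * a ≤ b := by
      intro a b x y ha hx h3 h4
      have : (1 - ε / 2) * a * x ≤ b * x := by rw [h3]; nlinarith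
      exact le_of_mul_le_mul_right this hx
    have fin : ∀ i : ℕ, m ≤ 2 * i + (R + 1) → 2 * i ≤ m + (R + 1) →
        (1 - ε / 2) * m.choose i ≤ m.choose j → (1 - ε) * m.choose (m / 2) ≤ m.choose j := by
      intro i h3 h4 h5
      have h6 := hM m hmM i h3 h4
      have h7 : (0 : ℝ) ≤ m.choose (m / 2) := by positivity
      have h8 : (1 - ε / 2) * ((1 - ε / 2) * (m.choose (m / 2) : ℝ)) ≤
          (1 - ε / 2) * m.choose i := mul_le_mul_of_nonneg_left h6 (by linarith)
      nlinarith [mul_nonneg (sq_nonneg ε) h7]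
    rcases le_total m (2 * j) with hj | hj
    · by_cases hj0 : 2 * j ≤ m + (R + 1)
      · refine fin j (by omega) hj0 ?_
        have h7 : (0 : ℝ) ≤ m.choose j := by positivity
        nlinarith
      obtain ⟨i, rfl⟩ : ∃ i, j = i + 1 := ⟨j - 1, by omega⟩
      refine fin i (by omega) (by omega) ?_
      have hc := Nat.choose_succ_right_eq m i
      have him : i ≤ m := by omega
      refine key _ _ (i + 1) (m - i) (by positivity) (by positivity) ?_ ?_
      · rw [← Nat.cast_sub him]; exact_mod_cast hc
      · have h8 : (2 * (i + 1) : ℝ) ≤ m + (R + 1 + 1) := by exact_mod_cast h2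
        nlinarith
    · by_cases hj0 : m ≤ 2 * j + (R + 1)
      · refine fin j hj0 (by omega) ?_
        have h7 : (0 : ℝ) ≤ m.choose j := by positivity
        nlinarith
      refine fin (j + 1) (by omega) (by omega) ?_
      have hc := Nat.choose_succ_right_eq m j
      have him : j ≤ m := by omega
      refine key _ _ (m - j) (j + 1) (by positivity) ?_ ?_ ?_
      · have : (j : ℝ) + 1 ≤ m := by exact_mod_cast (by omega : j + 1 ≤ m)
        linarith
      · rw [← Nat.cast_sub him]; exact_mod_cast hc.symm
      · have h8 : (m : ℝ) ≤ 2 * j + (R + 1 + 1) := by exact_mod_cast h1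
        nlinarith

/-! ### Geometric tails and the loss in a binomial electorate -/

section

variable {ν : ℝ}

/-- The limit weight of the lead exceeding `y` in steps of two. -/
noncomputable def tailSum (ν : ℝ) (y : ℤ) : ℝ := (ν - ν⁻¹)⁻¹ * ν ^ (min (y + 1) 0)

lemma sub_inv_pos_of_one_lt (hν : 1 < ν) : 0 < ν - ν⁻¹ := by
  have := inv_lt_one_of_one_lt₀ hν
  linarith

lemma tailSum_sub_of_neg (hν : 1 < ν) {y : ℤ} (hy : y < 0) :
    tailSum ν y - tailSum ν (y - 2) = ν ^ y := by
  have h0 : ν ≠ 0 := by positivity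
  have h1 := sub_inv_pos_of_one_lt hν
  unfold tailSum
  rw [min_eq_left (by omega), min_eq_left (by omega), show y - 2 + 1 = y - 1 by ring,
    zpow_add_one₀ h0, zpow_sub_one₀ h0, show (ν - ν⁻¹)⁻¹ * (ν ^ y * ν) -
    (ν - ν⁻¹)⁻¹ * (ν ^ y * ν⁻¹) = (ν - ν⁻¹)⁻¹ * (ν - ν⁻¹) * ν ^ y by ring,
    inv_mul_cancel₀ h1.ne', one_mul]

/-- The only slack is at a tie, where the left side is 1/(ν+1) and the right side 1/2. So an even
number of votes can only raise the loss above the telescoped value, and lower bounds need no parity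
assumption. -/
lemma tailSum_sub_le (hν : 1 < ν) (y : ℤ) :
    tailSum ν y - tailSum ν (y - 2) ≤ ν ^ y * lossAt y := by
  have h0 : ν ≠ 0 := by positivity
  have h1 := sub_inv_pos_of_one_lt hν
  rcases lt_trichotomy y 0 with h | h | h
  · rw [tailSum_sub_of_neg hν h, lossAt_of_neg h, mul_one]
  · subst h
    have e1 : min ((0 : ℤ) + 1) 0 = 0 := rfl
    have e2 : min ((0 : ℤ) - 2 + 1) 0 = -1 := rfl
    have e3 : lossAt 0 = 1 / 2 := by simp [lossAt]
    unfold tailSum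
    rw [e1, e2, e3, zpow_zero, zpow_neg_one, mul_one, one_mul]
    have h2 : 0 < ν := by positivity
    have h3 : ν⁻¹ * ν = 1 := inv_mul_cancel₀ h0
    have h4 : 0 < ν⁻¹ := by positivity
    rw [show (ν - ν⁻¹)⁻¹ - (ν - ν⁻¹)⁻¹ * ν⁻¹ = (1 - ν⁻¹) / (ν - ν⁻¹) by field_simp,
      div_le_iff₀ h1]
    nlinarith
  · rw [lossAt_of_pos h, mul_zero]
    unfold tailSum
    rw [min_eq_right (by omega), min_eq_right (by omega), sub_self]

lemma tailSum_sub_of_odd (hν : 1 < ν) {y : ℤ} (hy : Odd y) :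
    tailSum ν y - tailSum ν (y - 2) = ν ^ y * lossAt y := by
  rcases lt_trichotomy y 0 with h | h | h
  · rw [tailSum_sub_of_neg hν h, lossAt_of_neg h, mul_one]
  · subst h; simp at hy
  · rw [lossAt_of_pos h, mul_zero]
    unfold tailSum
    rw [min_eq_right (by omega), min_eq_right (by omega), sub_self]

lemma tailSum_nonneg (hν : 1 < ν) (y : ℤ) : 0 ≤ tailSum ν y := by
  have h1 := sub_inv_pos_of_one_lt hν
  unfold tailSum; positivity

lemma tailSum_le (hν : 1 < ν) (y : ℤ) : tailSum ν y ≤ (ν - ν⁻¹)⁻¹ := by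
  have h1 := sub_inv_pos_of_one_lt hν
  unfold tailSum
  have : ν ^ (min (y + 1) 0) ≤ 1 := by
    rw [← zpow_zero ν]
    exact zpow_le_zpow_right₀ hν.le (min_le_right _ _)
  exact mul_le_of_le_one_right (by positivity) this

/-- The probability of the wrong outcome when `m` voters with odds `ν ^ 2` of being correct vote,
and the correct alternative has a lead of `W` among the other votes. -/
noncomputable def binomLoss (ν : ℝ) (m : ℕ) (W : ℤ) : ℝ :=
  ∑ j ∈ Finset.range (m + 1),
    (m.choose j : ℝ) * ν ^ ((m : ℤ) - 2 * j) * lossAt (W + m - 2 * j) / (ν + ν⁻¹) ^ m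

/-- Replace every binomial coefficient by the central one; the remaining geometric sum over losing
leads telescopes through `tailSum`, exactly so because an odd number of votes rules out ties. -/
lemma binomLoss_le (hν : 1 < ν) (m : ℕ) (W : ℤ) (hW : Odd (W + m)) :
    binomLoss ν m W ≤
      centralProb m * (((ν + ν⁻¹) / 2) ^ m)⁻¹ * (ν - ν⁻¹)⁻¹ * ν ^ (-W) := by
  have h0 : ν ≠ 0 := by positivity
  have hp : 0 < ν := by positivity
  have hS : ∑ j ∈ Finset.range (m + 1), ν ^ (W + m - 2 * (j : ℤ)) * lossAt (W + m - 2 * j)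
      ≤ (ν - ν⁻¹)⁻¹ := by
    have : ∀ j ∈ Finset.range (m + 1),
        ν ^ (W + m - 2 * (j : ℤ)) * lossAt (W + m - 2 * j) =
          tailSum ν (W + m - 2 * (j : ℤ)) - tailSum ν (W + m - 2 * ((j + 1 : ℕ) : ℤ)) := by
      intro j _
      rw [← tailSum_sub_of_odd hν]
      · congr 2; push_cast; ring
      · rw [Int.odd_sub]; simp [hW]
    rw [Finset.sum_congr rfl this,
      Finset.sum_range_sub' (fun j : ℕ => tailSum ν (W + m - 2 * (j : ℤ)))]
    have h1 := tailSum_nonneg hν (W + m - 2 * ((m + 1 : ℕ) : ℤ))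
    have h2 := tailSum_le hν (W + m - 2 * ((0 : ℕ) : ℤ))
    linarith
  calc binomLoss ν m W
      ≤ ∑ j ∈ Finset.range (m + 1), (m.choose (m / 2) : ℝ) / (ν + ν⁻¹) ^ m * ν ^ (-W) *
          (ν ^ (W + m - 2 * (j : ℤ)) * lossAt (W + m - 2 * j)) := by
        refine Finset.sum_le_sum fun j _ => ?_
        have hc : (m.choose j : ℝ) ≤ m.choose (m / 2) := by
          exact_mod_cast Nat.choose_le_middle j m
        have hl := lossAt_nonneg (W + m - 2 * j)
        have hz : ν ^ (-W) * ν ^ (W + m - 2 * (j : ℤ)) = ν ^ ((m : ℤ) - 2 * j) := by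
          rw [← zpow_add₀ h0]; congr 1; ring
        rw [show (m.choose (m / 2) : ℝ) / (ν + ν⁻¹) ^ m * ν ^ (-W) *
          (ν ^ (W + m - 2 * (j : ℤ)) * lossAt (W + m - 2 * j)) =
          (m.choose (m / 2) : ℝ) * (ν ^ (-W) * ν ^ (W + m - 2 * (j : ℤ))) *
            lossAt (W + m - 2 * j) / (ν + ν⁻¹) ^ m by ring, hz]
        gcongr
    _ = (m.choose (m / 2) : ℝ) / (ν + ν⁻¹) ^ m * ν ^ (-W) *
          ∑ j ∈ Finset.range (m + 1), ν ^ (W + m - 2 * (j : ℤ)) * lossAt (W + m - 2 * j) := by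
        rw [Finset.mul_sum]
    _ ≤ (m.choose (m / 2) : ℝ) / (ν + ν⁻¹) ^ m * ν ^ (-W) * (ν - ν⁻¹)⁻¹ := by gcongr
    _ = _ := by
        unfold centralProb
        rw [div_pow]
        field_simp

/-- All but an ε/2 share of the geometric sum comes from boundedly many leads next to zero, and
there the binomial coefficients are within 1-ε/2 of the central one. -/
lemma exists_binomLoss_ge (hν : 1 < ν) (R : ℕ) {ε : ℝ} (hε : 0 < ε) :
    ∃ M : ℕ, ∀ m ≥ M, ∀ W : ℤ, |W| ≤ R →
      (1 - ε) * (centralProb m * (((ν + ν⁻¹) / 2) ^ m)⁻¹ * (ν - ν⁻¹)⁻¹ * ν ^ (-W)) ≤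
        binomLoss ν m W := by
  have h0 : ν ≠ 0 := by positivity
  have hp : 0 < ν := by positivity
  have hκ := sub_inv_pos_of_one_lt hν
  by_cases hε1 : 1 ≤ ε
  · refine ⟨0, fun m _ W _ => ?_⟩
    have h1 : 0 ≤ binomLoss ν m W := by
      refine Finset.sum_nonneg fun j _ => ?_
      have hl := lossAt_nonneg (W + m - 2 * j)
      positivity
    have h2 := (centralProb_pos m).le
    refine le_trans (mul_nonpos_of_nonpos_of_nonneg (by linarith) ?_) h1
    positivity
  push Not at hε1
  obtain ⟨L, hL⟩ : ∃ L : ℕ, (ν⁻¹) ^ L < ε / 2 :=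
    exists_pow_lt_of_lt_one (half_pos hε) (inv_lt_one_of_one_lt₀ hν)
  obtain ⟨M, hM⟩ := exists_choose_ge (R + 2 * L + 2) (half_pos hε)
  refine ⟨max M (R + 2 * L + 2), fun m hm W hW => ?_⟩
  have hmM : M ≤ m := le_trans (le_max_left _ _) hm
  have hmR : R + 2 * L + 2 ≤ m := le_trans (le_max_right _ _) hm
  obtain ⟨hW1, hW2⟩ := abs_le.1 hW
  -- With j₀ wrong voters the lead is 0 or 1, so the window of L+1 terms starts where `tailSum` is
  -- still at its maximum.
  obtain ⟨j₀, hj₀⟩ : ∃ j₀ : ℕ, (j₀ : ℤ) = (W + m) / 2 :=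
    ⟨((W + m) / 2).toNat, Int.toNat_of_nonneg (by omega)⟩
  have hS : (1 - ε / 2) * (ν - ν⁻¹)⁻¹ ≤ ∑ i ∈ Finset.range (L + 1),
      ν ^ (W + m - 2 * ((j₀ + i : ℕ) : ℤ)) * lossAt (W + m - 2 * ((j₀ + i : ℕ) : ℤ)) := by
    calc (1 - ε / 2) * (ν - ν⁻¹)⁻¹
        ≤ tailSum ν (W + m - 2 * ((j₀ + 0 : ℕ) : ℤ)) -
          tailSum ν (W + m - 2 * ((j₀ + (L + 1) : ℕ) : ℤ)) := by
          unfold tailSum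
          rw [min_eq_right (by push_cast; omega), zpow_zero]
          have h2 : ν ^ (min (W + m - 2 * ((j₀ + (L + 1) : ℕ) : ℤ) + 1) 0) ≤ ε / 2 := by
            refine le_trans ?_ hL.le
            rw [inv_pow, ← zpow_natCast, ← zpow_neg]
            exact zpow_le_zpow_right₀ hν.le (by push_cast; omega)
          have h3 : 0 < (ν - ν⁻¹)⁻¹ := by positivity
          nlinarith
      _ = ∑ i ∈ Finset.range (L + 1), (tailSum ν (W + m - 2 * ((j₀ + i : ℕ) : ℤ)) -
          tailSum ν (W + m - 2 * ((j₀ + (i + 1) : ℕ) : ℤ))) := by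
          rw [Finset.sum_range_sub' (fun i : ℕ => tailSum ν (W + m - 2 * ((j₀ + i : ℕ) : ℤ)))]
      _ ≤ _ := by
          refine Finset.sum_le_sum fun i _ => ?_
          refine le_trans (le_of_eq ?_) (tailSum_sub_le hν _)
          congr 2; push_cast; ring
  have hz : ∀ j : ℕ, ν ^ (-W) * ν ^ (W + m - 2 * (j : ℤ)) = ν ^ ((m : ℤ) - 2 * j) := by
    intro j
    rw [← zpow_add₀ h0]; congr 1; ring
  have hsub : Finset.Ico j₀ (j₀ + (L + 1)) ⊆ Finset.range (m + 1) := by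
    intro j hj
    simp only [Finset.mem_Ico, Finset.mem_range] at hj ⊢
    omega
  calc (1 - ε) * (centralProb m * (((ν + ν⁻¹) / 2) ^ m)⁻¹ * (ν - ν⁻¹)⁻¹ * ν ^ (-W))
      = (1 - ε) * ((m.choose (m / 2) : ℝ) / (ν + ν⁻¹) ^ m * ν ^ (-W) * (ν - ν⁻¹)⁻¹) := by
        unfold centralProb
        rw [div_pow]
        field_simp
    _ ≤ (1 - ε / 2) * ((m.choose (m / 2) : ℝ) / (ν + ν⁻¹) ^ m * ν ^ (-W) *
          ((1 - ε / 2) * (ν - ν⁻¹)⁻¹)) := by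
        rw [show (1 - ε / 2) * ((m.choose (m / 2) : ℝ) / (ν + ν⁻¹) ^ m * ν ^ (-W) *
          ((1 - ε / 2) * (ν - ν⁻¹)⁻¹)) = ((1 - ε / 2) * (1 - ε / 2)) *
          ((m.choose (m / 2) : ℝ) / (ν + ν⁻¹) ^ m * ν ^ (-W) * (ν - ν⁻¹)⁻¹) by ring]
        refine mul_le_mul_of_nonneg_right (by nlinarith) (by positivity)
    _ ≤ (1 - ε / 2) * ((m.choose (m / 2) : ℝ) / (ν + ν⁻¹) ^ m * ν ^ (-W) *
          ∑ i ∈ Finset.range (L + 1), ν ^ (W + m - 2 * ((j₀ + i : ℕ) : ℤ)) *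
            lossAt (W + m - 2 * ((j₀ + i : ℕ) : ℤ))) := by
        refine mul_le_mul_of_nonneg_left ?_ (by linarith)
        gcongr
    _ = ∑ i ∈ Finset.range (L + 1), ((1 - ε / 2) * (m.choose (m / 2) : ℝ)) *
          ν ^ ((m : ℤ) - 2 * ((j₀ + i : ℕ) : ℤ)) *
            lossAt (W + m - 2 * ((j₀ + i : ℕ) : ℤ)) / (ν + ν⁻¹) ^ m := by
        rw [Finset.mul_sum, Finset.mul_sum]
        refine Finset.sum_congr rfl fun i _ => ?_
        rw [← hz]; ring
    _ ≤ ∑ i ∈ Finset.range (L + 1), (m.choose (j₀ + i) : ℝ) *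
          ν ^ ((m : ℤ) - 2 * ((j₀ + i : ℕ) : ℤ)) *
            lossAt (W + m - 2 * ((j₀ + i : ℕ) : ℤ)) / (ν + ν⁻¹) ^ m := by
        refine Finset.sum_le_sum fun i hi => ?_
        have hi' := Finset.mem_range.1 hi
        have hc := hM m hmM (j₀ + i) (by omega) (by omega)
        have hl := lossAt_nonneg (W + m - 2 * ((j₀ + i : ℕ) : ℤ))
        gcongr
    _ = ∑ j ∈ Finset.Ico j₀ (j₀ + (L + 1)), (m.choose j : ℝ) *
          ν ^ ((m : ℤ) - 2 * j) * lossAt (W + m - 2 * j) / (ν + ν⁻¹) ^ m := by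
        rw [Finset.sum_Ico_eq_sum_range, Nat.add_sub_cancel_left]
    _ ≤ binomLoss ν m W := by
        refine Finset.sum_le_sum_of_subset_of_nonneg hsub fun j _ _ => ?_
        have hl := lossAt_nonneg (W + m - 2 * j)
        positivity

end

/-! ### The loss as a linear functional of generating functions -/

open LaurentPolynomial

/-- The expectation of `lossAt` under the distribution encoded by a Laurent polynomial. -/
noncomputable def lossFun : ℝ[T;T⁻¹] →ₗ[ℝ] ℝ where
  toFun f := Finsupp.linearCombination ℝ lossAt f.coeff
  map_add' f g := by simp
  map_smul' a f := by simp

lemma lossFun_single (y : ℤ) (a : ℝ) : lossFun (.single y a) = a * lossAt y := by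
  change Finsupp.linearCombination ℝ lossAt (AddMonoidAlgebra.single y a).coeff = _
  rw [AddMonoidAlgebra.coeff_single, Finsupp.linearCombination_single, smul_eq_mul]

/-- The generating function of the signed vote of a voter of precision `p` and weight `w`. -/
noncomputable def voterPoly (p : ℝ) (w : ℕ) : ℝ[T;T⁻¹] := .single (w : ℤ) p + .single (-(w : ℤ)) (1 - p)

lemma voterPoly_zero (p : ℝ) : voterPoly p 0 = 1 := by
  unfold voterPoly
  rw [Nat.cast_zero, neg_zero, ← AddMonoidAlgebra.single_add, add_sub_cancel,
    AddMonoidAlgebra.one_def]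

section

variable {κ : Type} [DecidableEq κ]

/-- The probability of the wrong outcome when voter `k` casts `w k` votes sincerely. -/
noncomputable def lossProb [Fintype κ] (p : κ → ℝ) (w : κ → ℕ) : ℝ := lossFun (∏ k, voterPoly (p k) (w k))

lemma prod_single {α : Type} (s : Finset α) (a : α → ℤ) (b : α → ℝ) :
    ∏ k ∈ s, (AddMonoidAlgebra.single (a k) (b k) : ℝ[T;T⁻¹]) =
      .single (∑ k ∈ s, a k) (∏ k ∈ s, b k) := by
  classical
  induction s using Finset.induction_on with
  | empty => rfl
  | insert k s hk ih =>
    rw [Finset.prod_insert hk, Finset.sum_insert hk, Finset.prod_insert hk, ih,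
      AddMonoidAlgebra.single_mul_single]

/-- The lead of the correct alternative among the voters in `A` when those in `t` are right. -/
def lead (w : κ → ℕ) (A t : Finset κ) : ℤ := ∑ k ∈ t, (w k : ℤ) - ∑ k ∈ A \ t, (w k : ℤ)

/-- The probability that among the voters in `A` exactly those in `t` are right. -/
noncomputable def setProb (p : κ → ℝ) (A t : Finset κ) : ℝ := (∏ k ∈ t, p k) * ∏ k ∈ A \ t, (1 - p k)

lemma prod_voterPoly (p : κ → ℝ) (w : κ → ℕ) (A : Finset κ) :
    ∏ k ∈ A, voterPoly (p k) (w k) =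
      ∑ t ∈ A.powerset, AddMonoidAlgebra.single (lead w A t) (setProb p A t) := by
  unfold voterPoly
  rw [Finset.prod_add]
  refine Finset.sum_congr rfl fun t _ => ?_
  rw [prod_single, prod_single, AddMonoidAlgebra.single_mul_single, Finset.sum_neg_distrib]
  rfl

lemma setProb_nonneg {p : κ → ℝ} (h0 : ∀ k, 0 ≤ p k) (h1 : ∀ k, p k ≤ 1) (A t : Finset κ) :
    0 ≤ setProb p A t :=
  mul_nonneg (Finset.prod_nonneg fun k _ => h0 k)
    (Finset.prod_nonneg fun k _ => sub_nonneg.2 (h1 k))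

lemma lossProb_eq_sum [Fintype κ] (p : κ → ℝ) (w : κ → ℕ) (A : Finset κ) (hA : ∀ k ∉ A, w k = 0) :
    lossProb p w = ∑ t ∈ A.powerset, setProb p A t * lossAt (lead w A t) := by
  unfold lossProb
  rw [← Finset.prod_subset (Finset.subset_univ A) (fun k _ hk => by rw [hA k hk, voterPoly_zero]),
    prod_voterPoly, map_sum]
  exact Finset.sum_congr rfl fun t _ => lossFun_single _ _

lemma lead_sdiff (w : κ → ℕ) {A t : Finset κ} (ht : t ⊆ A) : lead w A (A \ t) = -lead w A t := by
  unfold lead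
  rw [Finset.sdiff_sdiff_eq_self ht, neg_sub]

/-- The same sum indexed by the set of voters who are wrong. Adding it to `lossProb_eq_sum` pairs
each lead with its negative, so the weights cancel out. -/
lemma lossProb_eq_sum_flip [Fintype κ] (p : κ → ℝ) (w : κ → ℕ) (A : Finset κ) (hA : ∀ k ∉ A, w k = 0) :
    lossProb p w = ∑ t ∈ A.powerset, setProb p A (A \ t) * lossAt (-lead w A t) := by
  rw [lossProb_eq_sum p w A hA]
  refine Finset.sum_nbij' (fun t => A \ t) (fun t => A \ t) ?_ ?_ ?_ ?_ ?_
  · intro t _; simp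
  · intro t _; simp
  · intro t ht; exact Finset.sdiff_sdiff_eq_self (Finset.mem_powerset.1 ht)
  · intro t ht; exact Finset.sdiff_sdiff_eq_self (Finset.mem_powerset.1 ht)
  · intro t ht
    rw [lead_sdiff w (Finset.mem_powerset.1 ht), neg_neg,
      Finset.sdiff_sdiff_eq_self (Finset.mem_powerset.1 ht)]

/-! ### Exponential weights and two-sided estimates of the loss -/

variable {ν : ℝ}

/-- The exponential weight of a voter of precision `p` casting `w` votes. -/
noncomputable def expWeight (ν p : ℝ) (w : ℕ) : ℝ := p * ν ^ (-(w : ℤ)) + (1 - p) * ν ^ (w : ℤ)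

lemma expWeight_pos (hν : 1 < ν) {p : ℝ} (h0 : 0 < p) (h1 : p < 1) (w : ℕ) :
    0 < expWeight ν p w := by
  have h2 : 0 < ν := by positivity
  have h3 : 0 < 1 - p := by linarith
  unfold expWeight; positivity

lemma prod_expWeight (hν : 1 < ν) (p : κ → ℝ) (w : κ → ℕ) (A : Finset κ) :
    ∏ k ∈ A, expWeight ν (p k) (w k) =
      ∑ t ∈ A.powerset, setProb p A t * ν ^ (-lead w A t) := by
  have h0 : ν ≠ 0 := by positivity
  have hz : ∀ (s : Finset κ) (a : κ → ℤ), ∏ k ∈ s, ν ^ a k = ν ^ ∑ k ∈ s, a k := by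
    intro s a
    induction s using Finset.induction_on with
    | empty => simp
    | insert k s hk ih => rw [Finset.prod_insert hk, Finset.sum_insert hk, ih, zpow_add₀ h0]
  unfold expWeight
  rw [Finset.prod_add]
  refine Finset.sum_congr rfl fun t _ => ?_
  rw [Finset.prod_mul_distrib, Finset.prod_mul_distrib, hz, hz, Finset.sum_neg_distrib]
  unfold setProb lead
  rw [neg_sub, sub_eq_neg_add, zpow_add₀ h0]
  ring

/-- The precision of a voter with odds `ν ^ 2` of being correct. -/
noncomputable def basePrecision (ν : ℝ) : ℝ := ν / (ν + ν⁻¹)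

lemma one_sub_basePrecision (hν : 1 < ν) : 1 - basePrecision ν = ν⁻¹ / (ν + ν⁻¹) := by
  have h2 : 0 < ν := by positivity
  have h3 : ν + ν⁻¹ ≠ 0 := by positivity
  unfold basePrecision
  rw [eq_div_iff h3, sub_mul, div_mul_cancel₀ _ h3]; ring

lemma expWeight_base_one (hν : 1 < ν) : expWeight ν (basePrecision ν) 1 = ((ν + ν⁻¹) / 2)⁻¹ := by
  have h2 : 0 < ν := by positivity
  unfold expWeight
  rw [one_sub_basePrecision hν]
  unfold basePrecision
  rw [Nat.cast_one, zpow_neg_one, zpow_one]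
  field_simp
  ring

lemma lossFun_single_mul_pow (hν : 1 < ν) (m : ℕ) (W : ℤ) (a : ℝ) :
    lossFun (.single W a * voterPoly (basePrecision ν) 1 ^ m) = a * binomLoss ν m W := by
  have h0 : ν ≠ 0 := by positivity
  have hp : 0 < ν := by positivity
  unfold voterPoly
  rw [add_comm, add_pow, Finset.mul_sum, map_sum]
  unfold binomLoss
  rw [Finset.mul_sum]
  refine Finset.sum_congr rfl fun j hj => ?_
  have hj' : j ≤ m := Nat.lt_succ_iff.1 (Finset.mem_range.1 hj)
  rw [AddMonoidAlgebra.single_pow, AddMonoidAlgebra.single_pow,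
    AddMonoidAlgebra.single_mul_single, ← mul_assoc, AddMonoidAlgebra.single_mul_single,
    mul_comm, ← nsmul_eq_mul, map_nsmul, lossFun_single, nsmul_eq_mul]
  have e1 : W + (j • -((1 : ℕ) : ℤ) + (m - j) • ((1 : ℕ) : ℤ)) = W + m - 2 * j := by
    simp only [nsmul_eq_mul]; push_cast [hj']; ring
  have e2 : (1 - basePrecision ν) ^ j * basePrecision ν ^ (m - j) =
      ν ^ ((m : ℤ) - 2 * j) / (ν + ν⁻¹) ^ m := by
    rw [one_sub_basePrecision hν]
    unfold basePrecision
    rw [div_pow, div_pow, div_mul_div_comm, ← pow_add, Nat.add_sub_cancel' hj']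
    congr 1
    rw [← zpow_natCast, ← zpow_natCast, inv_zpow, ← zpow_neg, ← zpow_add₀ h0]
    congr 1; push_cast [hj']; ring
  rw [e1, e2]
  ring

/-- Condition on the voters in `B`, the exceptional ones; the others are interchangeable one-vote
nonexperts and are summed up by `binomLoss`. -/
lemma lossProb_split [Fintype κ] (hν : 1 < ν) (p : κ → ℝ) (w : κ → ℕ) (B : Finset κ)
    (hB : ∀ k ∉ B, p k = basePrecision ν ∧ w k = 1) :
    lossProb p w = ∑ t ∈ B.powerset, setProb p B t * binomLoss ν Bᶜ.card (lead w B t) := by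
  unfold lossProb
  rw [← Finset.prod_mul_prod_compl B, prod_voterPoly]
  have h : ∏ k ∈ Bᶜ, voterPoly (p k) (w k) = voterPoly (basePrecision ν) 1 ^ Bᶜ.card := by
    rw [← Finset.prod_const]
    refine Finset.prod_congr rfl fun k hk => ?_
    obtain ⟨h1, h2⟩ := hB k (Finset.mem_compl.1 hk)
    rw [h1, h2]
  rw [h, Finset.sum_mul, map_sum]
  exact Finset.sum_congr rfl fun t _ => lossFun_single_mul_pow hν _ _ _

lemma prod_expWeight_split [Fintype κ] (hν : 1 < ν) (p : κ → ℝ) (w : κ → ℕ) (B : Finset κ)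
    (hB : ∀ k ∉ B, p k = basePrecision ν ∧ w k = 1) :
    ∏ k, expWeight ν (p k) (w k) =
      (((ν + ν⁻¹) / 2) ^ Bᶜ.card)⁻¹ * ∏ k ∈ B, expWeight ν (p k) (w k) := by
  rw [← Finset.prod_mul_prod_compl B, mul_comm, ← inv_pow, ← expWeight_base_one hν,
    ← Finset.prod_const]
  congr 1
  refine Finset.prod_congr rfl fun k hk => ?_
  obtain ⟨h1, h2⟩ := hB k (Finset.mem_compl.1 hk)
  rw [h1, h2]

lemma odd_lead_add [Fintype κ] {w : κ → ℕ} {B t : Finset κ} (ht : t ⊆ B) (hB : ∀ k ∉ B, w k = 1)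
    (hw : Odd (∑ k, w k)) : Odd (lead w B t + Bᶜ.card) := by
  have h1 : (∑ k, (w k : ℤ)) = ∑ k ∈ t, (w k : ℤ) + ∑ k ∈ B \ t, (w k : ℤ) + Bᶜ.card := by
    rw [← Finset.sum_add_sum_compl B, ← Finset.sum_sdiff ht]
    have : ∑ k ∈ Bᶜ, (w k : ℤ) = Bᶜ.card := by
      rw [Finset.sum_congr rfl fun k hk => by rw [hB k (Finset.mem_compl.1 hk)]]
      simp
    rw [this]; ring
  have h2 : Odd (∑ k, (w k : ℤ)) := by exact_mod_cast hw
  rw [h1] at h2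
  unfold lead
  obtain ⟨a, ha⟩ := h2
  exact ⟨a - ∑ k ∈ B \ t, (w k : ℤ), by linarith⟩

/-- `binomLoss_le` depends on the lead W of the exceptional voters only through ν^(-W), and
averaging ν^(-W) over independent voters gives the product of their exponential weights. -/
lemma lossProb_le [Fintype κ] (hν : 1 < ν) {p : κ → ℝ} (h0 : ∀ k, 0 ≤ p k) (h1 : ∀ k, p k ≤ 1)
    {w : κ → ℕ} (hw : Odd (∑ k, w k)) (B : Finset κ)
    (hB : ∀ k ∉ B, p k = basePrecision ν ∧ w k = 1) :
    lossProb p w ≤ centralProb Bᶜ.card * (ν - ν⁻¹)⁻¹ * ∏ k, expWeight ν (p k) (w k) := by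
  rw [lossProb_split hν p w B hB, prod_expWeight_split hν p w B hB, prod_expWeight hν,
    Finset.mul_sum, Finset.mul_sum]
  refine Finset.sum_le_sum fun t ht => ?_
  have h2 := binomLoss_le hν Bᶜ.card (lead w B t)
    (odd_lead_add (Finset.mem_powerset.1 ht) (fun k hk => (hB k hk).2) hw)
  refine le_trans (mul_le_mul_of_nonneg_left h2 (setProb_nonneg h0 h1 B t)) (le_of_eq ?_)
  ring

lemma abs_lead_le (w : κ → ℕ) {B t : Finset κ} (ht : t ⊆ B) : |lead w B t| ≤ ∑ k ∈ B, (w k : ℤ) := by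
  rw [← Finset.sum_sdiff ht]
  unfold lead
  have h1 : 0 ≤ ∑ k ∈ t, (w k : ℤ) := Finset.sum_nonneg fun _ _ => by positivity
  have h2 : 0 ≤ ∑ k ∈ B \ t, (w k : ℤ) := Finset.sum_nonneg fun _ _ => by positivity
  rw [abs_le]; constructor <;> linarith

end

/-- The threshold depends only on ν, R and ε, not on the committee or the weights: the lead inside
`B` is bounded by its total weight, hence by R. -/
lemma exists_lossProb_ge {ν : ℝ} (hν : 1 < ν) (R : ℕ) {ε : ℝ} (hε : 0 < ε) :
    ∃ M : ℕ, ∀ {κ : Type} [Fintype κ] [DecidableEq κ] {p : κ → ℝ},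
      (∀ k, 0 ≤ p k) → (∀ k, p k ≤ 1) → ∀ {w : κ → ℕ} (B : Finset κ),
      (∀ k ∉ B, p k = basePrecision ν ∧ w k = 1) → M ≤ Bᶜ.card → ∑ k ∈ B, w k ≤ R →
      (1 - ε) * (centralProb Bᶜ.card * (ν - ν⁻¹)⁻¹ * ∏ k, expWeight ν (p k) (w k)) ≤
        lossProb p w := by
  obtain ⟨M, hM⟩ := exists_binomLoss_ge hν R hε
  refine ⟨M, ?_⟩
  intro κ _ _ p h0 h1 w B hB hMB hR
  rw [lossProb_split hν p w B hB, prod_expWeight_split hν p w B hB, prod_expWeight hν,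
    Finset.mul_sum, Finset.mul_sum, Finset.mul_sum]
  refine Finset.sum_le_sum fun t ht => ?_
  have h2 := hM _ hMB (lead w B t) ((abs_lead_le w (Finset.mem_powerset.1 ht)).trans
    (by exact_mod_cast hR))
  refine le_trans (le_of_eq ?_) (mul_le_mul_of_nonneg_left h2 (setProb_nonneg h0 h1 B t))
  ring

/-- A bound free of any control on the weights. Take the events in which half of `Y` is right, with
all of `X` wrong, and their reversals. Each has at least the stated probability, and since the leads
in a reversed pair are opposite, their losses sum to one. -/
lemma lossProb_ge_of_active {κ : Type} [Fintype κ] [DecidableEq κ] {ν : ℝ} (hν : 1 < ν)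
    {p : κ → ℝ} (h0 : ∀ k, 1 / 2 ≤ p k) (h1 : ∀ k, p k ≤ 1) {w : κ → ℕ} (X Y : Finset κ)
    (hXY : Disjoint X Y) (hw : ∀ k ∉ X ∪ Y, w k = 0) (hY : ∀ k ∈ Y, p k = basePrecision ν) :
    (∏ k ∈ X, (1 - p k)) * ν⁻¹ / 2 * (centralProb Y.card * (((ν + ν⁻¹) / 2) ^ Y.card)⁻¹) ≤
      lossProb p w := by
  have hp : 0 < ν := by positivity
  have hne : ν ≠ 0 := hp.ne'
  set m := Y.card with hm
  set A := X ∪ Y with hA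
  set c : ℝ := (∏ k ∈ X, (1 - p k)) * (ν⁻¹ / (ν + ν⁻¹) ^ m) with hc
  have hsub : Y.powersetCard (m / 2) ⊆ A.powerset := by
    intro s hs
    exact Finset.mem_powerset.2 ((Finset.mem_powersetCard.1 hs).1.trans Finset.subset_union_right)
  have hp0 : ∀ k, 0 ≤ p k := fun k => by linarith [h0 k]
  have hX0 : 0 ≤ ∏ k ∈ X, (1 - p k) := Finset.prod_nonneg fun k _ => sub_nonneg.2 (h1 k)
  have hXle : ∏ k ∈ X, (1 - p k) ≤ ∏ k ∈ X, p k :=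
    Finset.prod_le_prod (fun k _ => sub_nonneg.2 (h1 k)) fun k _ => by linarith [h0 k]
  -- The factor ν⁻¹ covers odd m, where the right voters may be one fewer than the wrong ones.
  have hpow : ∀ a b : ℕ, a + b = m → b ≤ a + 1 →
      ν⁻¹ / (ν + ν⁻¹) ^ m ≤ basePrecision ν ^ a * (1 - basePrecision ν) ^ b := by
    intro a b hab hba
    rw [one_sub_basePrecision hν]
    unfold basePrecision
    rw [div_pow, div_pow, div_mul_div_comm, ← pow_add, hab]
    refine div_le_div_of_nonneg_right ?_ (by positivity)
    rw [← zpow_natCast, ← zpow_natCast, inv_zpow, ← zpow_neg, ← zpow_add₀ hne, ← zpow_neg_one]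
    exact zpow_le_zpow_right₀ hν.le (by omega)
  have key : ∀ s ∈ Y.powersetCard (m / 2), c ≤ setProb p A s ∧ c ≤ setProb p A (A \ s) := by
    intro s hs
    obtain ⟨hsY, hsc⟩ := Finset.mem_powersetCard.1 hs
    have hXs : Disjoint X s := Finset.disjoint_of_subset_right hsY hXY
    have hAs : A \ s = X ∪ (Y \ s) := by
      rw [hA, Finset.union_sdiff_distrib, Finset.sdiff_eq_self_of_disjoint hXs]
    have hd : Disjoint X (Y \ s) := Finset.disjoint_of_subset_right Finset.sdiff_subset hXY
    have hcard : (Y \ s).card = m - m / 2 := by rw [Finset.card_sdiff_of_subset hsY, hsc]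
    have e1 : ∏ k ∈ s, p k = basePrecision ν ^ (m / 2) := by
      rw [← hsc]; exact Finset.prod_eq_pow_card fun k hk => hY k (hsY hk)
    have e2 : ∏ k ∈ s, (1 - p k) = (1 - basePrecision ν) ^ (m / 2) := by
      rw [← hsc]; exact Finset.prod_eq_pow_card fun k hk => by rw [hY k (hsY hk)]
    have e3 : ∏ k ∈ Y \ s, p k = basePrecision ν ^ (m - m / 2) := by
      rw [← hcard]; exact Finset.prod_eq_pow_card fun k hk => hY k (Finset.sdiff_subset hk)
    have e4 : ∏ k ∈ Y \ s, (1 - p k) = (1 - basePrecision ν) ^ (m - m / 2) := by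
      rw [← hcard]
      exact Finset.prod_eq_pow_card fun k hk => by rw [hY k (Finset.sdiff_subset hk)]
    constructor
    · unfold setProb
      rw [hAs, Finset.prod_union hd, e1, e4, hc, mul_left_comm]
      exact mul_le_mul_of_nonneg_left (hpow _ _ (by omega) (by omega)) hX0
    · unfold setProb
      rw [Finset.sdiff_sdiff_eq_self (hsY.trans Finset.subset_union_right), hAs,
        Finset.prod_union hd, e3, e2, hc, mul_assoc]
      refine mul_le_mul hXle (hpow _ _ (by omega) (by omega)) (by positivity) ?_
      exact Finset.prod_nonneg fun k _ => hp0 k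
  have hcardc : ((Y.powersetCard (m / 2)).card : ℝ) = m.choose (m / 2) := by
    rw [Finset.card_powersetCard]
  have b1 : ∑ s ∈ Y.powersetCard (m / 2), c * lossAt (lead w A s) ≤ lossProb p w := by
    rw [lossProb_eq_sum p w A hw]
    refine le_trans (Finset.sum_le_sum fun s hs =>
      mul_le_mul_of_nonneg_right (key s hs).1 (lossAt_nonneg _)) ?_
    exact Finset.sum_le_sum_of_subset_of_nonneg hsub fun s _ _ =>
      mul_nonneg (setProb_nonneg hp0 h1 _ _) (lossAt_nonneg _)
  have b2 : ∑ s ∈ Y.powersetCard (m / 2), c * lossAt (-lead w A s) ≤ lossProb p w := by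
    rw [lossProb_eq_sum_flip p w A hw]
    refine le_trans (Finset.sum_le_sum fun s hs =>
      mul_le_mul_of_nonneg_right (key s hs).2 (lossAt_nonneg _)) ?_
    exact Finset.sum_le_sum_of_subset_of_nonneg hsub fun s _ _ =>
      mul_nonneg (setProb_nonneg hp0 h1 _ _) (lossAt_nonneg _)
  have b3 : ∑ s ∈ Y.powersetCard (m / 2), c * lossAt (lead w A s) +
      ∑ s ∈ Y.powersetCard (m / 2), c * lossAt (-lead w A s) = m.choose (m / 2) * c := by
    rw [← Finset.sum_add_distrib, ← hcardc, ← nsmul_eq_mul, ← Finset.sum_const]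
    refine Finset.sum_congr rfl fun s _ => ?_
    rw [← mul_add, lossAt_add_neg, mul_one]
  have b4 : (∏ k ∈ X, (1 - p k)) * ν⁻¹ / 2 * (centralProb m * (((ν + ν⁻¹) / 2) ^ m)⁻¹) =
      m.choose (m / 2) * c / 2 := by
    rw [hc]
    unfold centralProb
    rw [div_pow]
    field_simp
  rw [b4]
  linarith

/-! ### The normalized loss of one voter and its minimizers -/

section

variable {ν : ℝ}

/-- The contribution of a voter to the asymptotic loss, normalized by the number of votes cast. -/
noncomputable def voterLoss (ν p : ℝ) (w : ℕ) : ℝ := ((ν + ν⁻¹) / 2) ^ w * expWeight ν p w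

lemma one_lt_half_add_inv (hν : 1 < ν) : 1 < (ν + ν⁻¹) / 2 := by
  have h2 : 0 < ν := by positivity
  have h3 : ν⁻¹ * ν = 1 := inv_mul_cancel₀ h2.ne'
  have h4 : 0 < ν⁻¹ := by positivity
  nlinarith [sq_nonneg (ν - 1)]

lemma voterLoss_pos (hν : 1 < ν) {p : ℝ} (h0 : 0 < p) (h1 : p < 1) (w : ℕ) :
    0 < voterLoss ν p w := by
  have := expWeight_pos hν h0 h1 w
  have := one_lt_half_add_inv hν
  unfold voterLoss; positivity

/-- The optimal weight appears here: the increment has the sign of (1-p)ν^(2(w+1)) - p, hence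
`voterLoss` falls until w reaches ⌊w*⌋ and does not fall afterwards. -/
lemma exists_voterLoss_succ_sub (hν : 1 < ν) (p : ℝ) (w : ℕ) :
    ∃ a > 0, voterLoss ν p (w + 1) - voterLoss ν p w = a * ((1 - p) * (ν ^ 2) ^ (w + 1) - p) := by
  have h2 : 0 < ν := by positivity
  have hc := one_lt_half_add_inv hν
  refine ⟨((ν + ν⁻¹) / 2) ^ w * ((ν ^ 2 - 1) / 2 * (ν ^ w)⁻¹ * (ν ^ 2)⁻¹), ?_, ?_⟩
  · have : 0 < ν ^ 2 - 1 := by nlinarith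
    positivity
  · unfold voterLoss expWeight
    rw [zpow_neg, zpow_neg, zpow_natCast, zpow_natCast]
    have e1 : ν ^ (w + 1) = ν ^ w * ν := pow_succ _ _
    have e2 : (ν ^ 2) ^ (w + 1) = ν ^ w * ν ^ w * ν ^ 2 := by ring
    have h3 : ν ^ w ≠ 0 := by positivity
    rw [e1, e2, pow_succ]
    generalize ν ^ w = x at *
    field_simp
    ring

lemma voterLoss_succ_le_iff (hν : 1 < ν) (p : ℝ) (w : ℕ) :
    voterLoss ν p (w + 1) ≤ voterLoss ν p w ↔ (1 - p) * (ν ^ 2) ^ (w + 1) ≤ p := by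
  obtain ⟨a, ha, h⟩ := exists_voterLoss_succ_sub hν p w
  rw [← sub_nonpos, h, ← sub_nonpos (b := p)]
  constructor
  · intro h1; by_contra h2; push Not at h2; nlinarith [mul_pos ha h2]
  · intro h1; nlinarith

lemma voterLoss_le_succ_iff (hν : 1 < ν) (p : ℝ) (w : ℕ) :
    voterLoss ν p w ≤ voterLoss ν p (w + 1) ↔ p ≤ (1 - p) * (ν ^ 2) ^ (w + 1) := by
  obtain ⟨a, ha, h⟩ := exists_voterLoss_succ_sub hν p w
  rw [← sub_nonneg, h, ← sub_nonneg (a := (1 - p) * _)]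
  constructor
  · intro h1; by_contra h2; push Not at h2; nlinarith [mul_pos ha (neg_pos.2 h2)]
  · intro h1; nlinarith

lemma voterLoss_base_zero (p : ℝ) : voterLoss ν p 0 = 1 := by
  simp [voterLoss, expWeight]

lemma voterLoss_base_one (hν : 1 < ν) : voterLoss ν (basePrecision ν) 1 = 1 := by
  have := one_lt_half_add_inv hν
  unfold voterLoss
  rw [expWeight_base_one hν, pow_one, mul_inv_cancel₀ (by positivity)]

lemma basePrecision_pos (hν : 1 < ν) : 0 < basePrecision ν := by
  have h2 : 0 < ν := by positivity
  unfold basePrecision; positivity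

lemma one_sub_basePrecision_pos (hν : 1 < ν) : 0 < 1 - basePrecision ν := by
  have h2 : 0 < ν := by positivity
  rw [one_sub_basePrecision hν]; positivity

lemma basePrecision_eq (hν : 1 < ν) : basePrecision ν = (1 - basePrecision ν) * ν ^ 2 := by
  have h2 : 0 < ν := by positivity
  rw [one_sub_basePrecision hν]
  unfold basePrecision
  field_simp

lemma half_lt_basePrecision (hν : 1 < ν) : 1 / 2 < basePrecision ν := by
  have h1 := basePrecision_eq hν
  have h2 := one_sub_basePrecision_pos hν
  have h3 : 1 < ν ^ 2 := by nlinarith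
  nlinarith

/-- At two votes the exponential weight is 1, leaving c² ≥ c, and further votes only increase the
loss. This is a penalty uniform in w for delegating to a nonexpert. -/
lemma voterLoss_base_of_two_le (hν : 1 < ν) {w : ℕ} (hw : 2 ≤ w) :
    (ν + ν⁻¹) / 2 ≤ voterLoss ν (basePrecision ν) w := by
  have h0 : 0 < ν := by positivity
  have hc := one_lt_half_add_inv hν
  induction w, hw using Nat.le_induction with
  | base =>
    have : expWeight ν (basePrecision ν) 2 = 1 := by
      unfold expWeight
      rw [one_sub_basePrecision hν]
      unfold basePrecision
      rw [zpow_neg, Nat.cast_ofNat, zpow_ofNat]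
      field_simp
      ring
    unfold voterLoss
    rw [this]; nlinarith
  | succ w hw ih =>
    refine ih.trans ((voterLoss_le_succ_iff hν _ _).2 ?_)
    have h1 := one_sub_basePrecision_pos hν
    have h2 : ν ^ 2 ≤ (ν ^ 2) ^ (w + 1) := le_self_pow₀ (by nlinarith) (by omega)
    calc basePrecision ν = (1 - basePrecision ν) * ν ^ 2 := basePrecision_eq hν
      _ ≤ _ := by gcongr

lemma one_le_prod_of_one_le {α : Type} {s : Finset α} {g : α → ℝ} (h : ∀ a ∈ s, 1 ≤ g a) :
    1 ≤ ∏ a ∈ s, g a := by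
  calc (1 : ℝ) = ∏ _a ∈ s, 1 := by simp
    _ ≤ _ := Finset.prod_le_prod (fun _ _ => zero_le_one) h

lemma one_le_voterLoss_base (hν : 1 < ν) (w : ℕ) : 1 ≤ voterLoss ν (basePrecision ν) w := by
  rcases w with _ | _ | w
  · rw [voterLoss_base_zero]
  · rw [zero_add, voterLoss_base_one hν]
  · exact (one_lt_half_add_inv hν).le.trans (voterLoss_base_of_two_le hν (by omega))

lemma pow_mul_prod_expWeight {κ : Type} [Fintype κ] (p : κ → ℝ) (w : κ → ℕ) :
    ((ν + ν⁻¹) / 2) ^ (∑ k, w k) * ∏ k, expWeight ν (p k) (w k) =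
      ∏ k, voterLoss ν (p k) (w k) := by
  unfold voterLoss
  rw [Finset.prod_mul_distrib, Finset.prod_pow_eq_pow_sum]

/-- If the optimal floor `f` satisfies `f ≤ w* < f + 1`, it minimizes `voterLoss`. -/
lemma voterLoss_floor_le (hν : 1 < ν) {p : ℝ} (h1 : p < 1) {f : ℕ}
    (hf : (1 - p) * (ν ^ 2) ^ f ≤ p) (hf' : p < (1 - p) * (ν ^ 2) ^ (f + 1)) (w : ℕ) :
    voterLoss ν p f ≤ voterLoss ν p w := by
  have hp : 0 < 1 - p := by linarith
  have hν2 : 1 < ν ^ 2 := by nlinarith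
  rcases le_total w f with h | h
  · induction h using Nat.decreasingInduction with
    | self => exact le_rfl
    | of_succ k hk ih =>
      refine ih.trans ((voterLoss_succ_le_iff hν p k).2 (le_trans ?_ hf))
      have : (ν ^ 2) ^ (k + 1) ≤ (ν ^ 2) ^ f := pow_le_pow_right₀ hν2.le hk
      gcongr
  · induction w, h using Nat.le_induction with
    | base => exact le_rfl
    | succ k hk ih =>
      refine ih.trans ((voterLoss_le_succ_iff hν p k).2 (le_trans hf'.le ?_))
      have : (ν ^ 2) ^ (f + 1) ≤ (ν ^ 2) ^ (k + 1) := pow_le_pow_right₀ hν2.le (by omega)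
      gcongr

/-- The increments vanish only if w+1 equals w* exactly, so the minimizer is unique except for the
pair w*-1, w* at an integer optimal weight. -/
lemma eq_of_voterLoss_eq (hν : 1 < ν) {p : ℝ} (h1 : p < 1) {f : ℕ}
    (hf : (1 - p) * (ν ^ 2) ^ f ≤ p) (hf' : p < (1 - p) * (ν ^ 2) ^ (f + 1)) {w : ℕ}
    (hw : voterLoss ν p w = voterLoss ν p f) :
    w = f ∨ (w + 1 = f ∧ (1 - p) * (ν ^ 2) ^ f = p) := by
  have hp : 0 < 1 - p := by linarith
  have hν2 : 1 < ν ^ 2 := by nlinarith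
  have hmin := voterLoss_floor_le hν h1 hf hf'
  rcases lt_trichotomy w f with h | h | h
  · right
    have h2 : voterLoss ν p w ≤ voterLoss ν p (w + 1) := hw.le.trans (hmin _)
    have h3 := (voterLoss_le_succ_iff hν p w).1 h2
    have h4 : w + 1 = f := by
      by_contra h5
      have h6 : (ν ^ 2) ^ (w + 1) < (ν ^ 2) ^ f := pow_lt_pow_right₀ hν2 (by omega)
      nlinarith
    exact ⟨h4, le_antisymm hf (h4 ▸ h3)⟩
  · exact Or.inl h
  · exfalso
    obtain ⟨k, rfl⟩ : ∃ k, w = k + 1 := ⟨w - 1, by omega⟩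
    have h2 : voterLoss ν p (k + 1) ≤ voterLoss ν p k := hw.le.trans (hmin _)
    have h3 := (voterLoss_succ_le_iff hν p k).1 h2
    have h6 : (ν ^ 2) ^ (f + 1) ≤ (ν ^ 2) ^ (k + 1) := pow_le_pow_right₀ hν2.le (by omega)
    nlinarith

/-! ### Comparison of weight vectors in large committees -/

/-- A uniform relative gap for finitely many values above a positive minimum. -/
lemma exists_relative_gap {α : Type} (s : Finset α) (g g₀ : α → ℝ) (h0 : ∀ a ∈ s, 0 < g₀ a)
    (h : ∀ a ∈ s, g₀ a ≤ g a) :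
    ∃ δ > 0, ∀ a ∈ s, g a ≠ g₀ a → (1 + δ) * g₀ a ≤ g a := by
  classical
  induction s using Finset.induction_on with
  | empty => exact ⟨1, one_pos, by simp⟩
  | insert a s ha ih =>
    obtain ⟨δ, hδ, H⟩ := ih (fun b hb => h0 b (Finset.mem_insert_of_mem hb))
      fun b hb => h b (Finset.mem_insert_of_mem hb)
    have ha0 := h0 a (Finset.mem_insert_self _ _)
    have hag := h a (Finset.mem_insert_self _ _)
    by_cases he : g a = g₀ a
    · refine ⟨δ, hδ, fun b hb hne => ?_⟩
      rcases Finset.mem_insert.1 hb with rfl | hb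
      · exact absurd he hne
      · exact H b hb hne
    · have hlt : g₀ a < g a := lt_of_le_of_ne hag (Ne.symm he)
      refine ⟨min δ (g a / g₀ a - 1), lt_min hδ ?_, fun b hb hne => ?_⟩
      · rw [sub_pos, one_lt_div ha0]; exact hlt
      rcases Finset.mem_insert.1 hb with rfl | hb
      · calc (1 + min δ (g b / g₀ b - 1)) * g₀ b ≤ (1 + (g b / g₀ b - 1)) * g₀ b := by
              gcongr; exact min_le_right _ _
          _ = g b := by rw [add_sub_cancel, div_mul_cancel₀ _ ha0.ne']
      · refine le_trans ?_ (H b hb hne)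
        have := h0 b (Finset.mem_insert_of_mem hb)
        gcongr; exact min_le_left _ _

/-- A weight vector attaining the asymptotic minimum of the loss: all votes are cast, nonexperts
cast at most one, and expert weights are as good as `f`. -/
def LimitOptimal (ν : ℝ) {n E : ℕ} (r : Fin E → ℝ) (f : Fin E → ℕ) (w : Fin n ⊕ Fin E → ℕ) :
    Prop :=
  ∑ k, w k = n + E ∧ (∀ j, w (.inl j) ≤ 1) ∧
    ∀ i, voterLoss ν (r i) (w (.inr i)) = voterLoss ν (r i) (f i)

/-- Each way of failing to be limit optimal contributes its own factor above one: c for an uncast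
vote, c for a nonexpert with two or more votes, and the gap 1+δ for an expert with a suboptimal
weight. -/
lemma prod_voterLoss_ge (hν : 1 < ν) {n E : ℕ} {r : Fin E → ℝ} {f : Fin E → ℕ}
    (hr0 : ∀ i, 0 < r i) (hr1 : ∀ i, r i < 1)
    (hmin : ∀ i v, voterLoss ν (r i) (f i) ≤ voterLoss ν (r i) v)
    {w : Fin n ⊕ Fin E → ℕ} (hw : ∑ k, w k ≤ n + E) (hopt : ¬ LimitOptimal ν r f w)
    {δ : ℝ} (hδ : 0 < δ) (hδc : 1 + δ ≤ (ν + ν⁻¹) / 2)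
    (hgap : ∀ i, voterLoss ν (r i) (w (.inr i)) ≠ voterLoss ν (r i) (f i) →
      (1 + δ) * voterLoss ν (r i) (f i) ≤ voterLoss ν (r i) (w (.inr i))) :
    (1 + δ) * ∏ i, voterLoss ν (r i) (f i) ≤ ((ν + ν⁻¹) / 2) ^ (n + E) *
      ∏ k, expWeight ν (committee n E (basePrecision ν) r k) (w k) := by
  have hc := one_lt_half_add_inv hν
  set c := (ν + ν⁻¹) / 2 with hcdef
  have hsplit : c ^ (n + E) * ∏ k, expWeight ν (committee n E (basePrecision ν) r k) (w k) =
      c ^ (n + E - ∑ k, w k) * (∏ j, voterLoss ν (basePrecision ν) (w (.inl j))) *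
        ∏ i, voterLoss ν (r i) (w (.inr i)) := by
    have h1 := pow_mul_prod_expWeight (ν := ν) (committee n E (basePrecision ν) r) w
    rw [Fintype.prod_sum_type (fun k => voterLoss ν (committee n E (basePrecision ν) r k) (w k))]
      at h1
    simp only [committee, Sum.elim_inl, Sum.elim_inr] at h1
    rw [mul_assoc, ← h1, ← mul_assoc, ← pow_add, Nat.sub_add_cancel hw]
    rfl
  rw [hsplit]
  have hΓ : 0 < ∏ i, voterLoss ν (r i) (f i) :=
    Finset.prod_pos fun i _ => voterLoss_pos hν (hr0 i) (hr1 i) _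
  have hx : 1 ≤ c ^ (n + E - ∑ k, w k) := one_le_pow₀ hc.le
  have hy : 1 ≤ ∏ j, voterLoss ν (basePrecision ν) (w (.inl j)) :=
    one_le_prod_of_one_le fun j _ => one_le_voterLoss_base hν _
  have hz : ∏ i, voterLoss ν (r i) (f i) ≤ ∏ i, voterLoss ν (r i) (w (.inr i)) :=
    Finset.prod_le_prod (fun i _ => (voterLoss_pos hν (hr0 i) (hr1 i) _).le) fun i _ => hmin i _
  set x := c ^ (n + E - ∑ k, w k) with hxdef
  set y := ∏ j, voterLoss ν (basePrecision ν) (w (.inl j)) with hydef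
  set z := ∏ i, voterLoss ν (r i) (w (.inr i)) with hzdef
  set Γ := ∏ i, voterLoss ν (r i) (f i) with hΓdef
  have hxy : 1 ≤ x * y := one_le_mul_of_one_le_of_one_le hx hy
  suffices h : 1 + δ ≤ x * y ∨ (1 + δ) * Γ ≤ z by
    rcases h with h | h
    · exact mul_le_mul h hz hΓ.le (by linarith)
    · calc (1 + δ) * Γ ≤ z := h
        _ ≤ x * y * z := le_mul_of_one_le_left (by linarith) hxy
  unfold LimitOptimal at hopt
  by_cases h1 : ∑ k, w k = n + E
  · by_cases h2 : ∀ j, w (.inl j) ≤ 1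
    · right
      have h3 : ∃ i, voterLoss ν (r i) (w (.inr i)) ≠ voterLoss ν (r i) (f i) := by
        by_contra h4; push Not at h4; exact hopt ⟨h1, h2, h4⟩
      obtain ⟨i, hi⟩ := h3
      rw [hΓdef, hzdef, ← Finset.mul_prod_erase _ _ (Finset.mem_univ i),
        ← Finset.mul_prod_erase _ _ (Finset.mem_univ i), ← mul_assoc]
      refine mul_le_mul (hgap i hi) ?_ ?_ (voterLoss_pos hν (hr0 i) (hr1 i) _).le
      · exact Finset.prod_le_prod (fun i _ => (voterLoss_pos hν (hr0 i) (hr1 i) _).le)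
          fun i _ => hmin i _
      · exact Finset.prod_nonneg fun i _ => (voterLoss_pos hν (hr0 i) (hr1 i) _).le
    · left
      push Not at h2
      obtain ⟨j, hj⟩ := h2
      refine hδc.trans (le_trans ?_ (le_mul_of_one_le_left (by linarith) hx))
      refine (voterLoss_base_of_two_le hν (by omega : 2 ≤ w (.inl j))).trans ?_
      rw [hydef, ← Finset.mul_prod_erase _ _ (Finset.mem_univ j)]
      refine le_mul_of_one_le_right ?_ (one_le_prod_of_one_le fun j _ => one_le_voterLoss_base hν _)
      linarith [one_le_voterLoss_base hν (w (.inl j))]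
  · left
    refine hδc.trans (le_trans ?_ (le_mul_of_one_le_right (by linarith) hy))
    exact le_self_pow₀ hc.le (by omega)

lemma committee_bounds (hν : 1 < ν) {n E : ℕ} {r : Fin E → ℝ}
    (hr : ∀ i, basePrecision ν < r i ∧ r i < 1) (k : Fin n ⊕ Fin E) :
    1 / 2 < committee n E (basePrecision ν) r k ∧ committee n E (basePrecision ν) r k < 1 := by
  have h1 := half_lt_basePrecision hν
  have h2 := one_sub_basePrecision_pos hν
  rcases k with j | i
  · exact ⟨h1, by simp only [committee, Sum.elim_inl]; linarith⟩
  · exact ⟨h1.trans (hr i).1, (hr i).2⟩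

/-- If more than a bounded number of nonexperts are inactive, the crude bound suffices. Otherwise
almost all nonexperts cast exactly one vote, so the sharp estimate applies, and the relative gap δ
outweighs its errors. -/
theorem exists_lossProb_lt (hν : 1 < ν) {E : ℕ} (hE : Odd E) {r : Fin E → ℝ}
    (hr : ∀ i, basePrecision ν < r i ∧ r i < 1) {f : Fin E → ℕ} (hf1 : ∀ i, 1 ≤ f i)
    (hmin : ∀ i v, voterLoss ν (r i) (f i) ≤ voterLoss ν (r i) v) :
    ∃ nbar : ℕ, ∀ n ≥ nbar, Even n → ∀ w₀ w : Fin n ⊕ Fin E → ℕ,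
      ∑ k, w₀ k = n + E → (∀ j, w₀ (.inl j) ≤ 1) → (∀ i, w₀ (.inr i) = f i) →
      ∑ k, w k ≤ n + E → ¬ LimitOptimal ν r f w →
      lossProb (committee n E (basePrecision ν) r) w₀ <
        lossProb (committee n E (basePrecision ν) r) w := by
  have hν0 : 0 < ν := by positivity
  have hc := one_lt_half_add_inv hν
  set c := (ν + ν⁻¹) / 2 with hcdef
  have hκ := sub_inv_pos_of_one_lt hν
  have hr0 : ∀ i, 0 < r i := fun i => (basePrecision_pos hν).trans (hr i).1
  have hr1 : ∀ i, r i < 1 := fun i => (hr i).2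
  set Γ := ∏ i, voterLoss ν (r i) (f i) with hΓdef
  have hΓ : 0 < Γ := Finset.prod_pos fun i _ => voterLoss_pos hν (hr0 i) (hr1 i) _
  set c₀ := (∏ i, (1 - r i)) * ν⁻¹ / 2 with hc₀def
  have hc₀ : 0 < c₀ := by
    have : 0 < ∏ i, (1 - r i) := Finset.prod_pos fun i _ => sub_pos.2 (hr1 i)
    positivity
  set F := ∑ i, f i with hF
  have hEF : E ≤ F := by
    calc E = ∑ _i : Fin E, 1 := by simp
      _ ≤ F := Finset.sum_le_sum fun i _ => hf1 i
  -- K inactive nonexperts, beyond the allowance F, already cost a factor c^K that beats the ratio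
  -- of the constants in the crude and the sharp bounds.
  obtain ⟨K, hK⟩ : ∃ K : ℕ, (ν - ν⁻¹)⁻¹ * Γ / c₀ < c ^ K := pow_unbounded_of_one_lt _ hc
  rw [div_lt_iff₀ hc₀] at hK
  set R := 2 * (K + F) with hR
  obtain ⟨δ₀, hδ₀, hgap₀⟩ := exists_relative_gap
    (Finset.univ ×ˢ Finset.range (R + 1) : Finset (Fin E × ℕ))
    (fun a => voterLoss ν (r a.1) a.2) (fun a => voterLoss ν (r a.1) (f a.1))
    (fun a _ => voterLoss_pos hν (hr0 _) (hr1 _) _) (fun a _ => hmin _ _)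
  -- The bound c-1 lets c itself serve as a gap factor; the bound 1 makes (1-δ/4)(1+δ) exceed 1+δ/4
  -- at the end.
  set δ := min δ₀ (min 1 (c - 1)) with hδdef
  have hδ : 0 < δ := lt_min hδ₀ (lt_min one_pos (by linarith))
  have hδ1 : δ ≤ 1 := (min_le_right _ _).trans (min_le_left _ _)
  have hδc : 1 + δ ≤ c := by
    have : δ ≤ c - 1 := (min_le_right _ _).trans (min_le_right _ _)
    linarith
  obtain ⟨M, hM⟩ := exists_lossProb_ge hν R (by positivity : 0 < δ / 4)
  -- Ensures n ≤ (1+δ/4)m' for m' = n+E-F, so replacing m' by n in the central probability costs at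
  -- most 1+δ/4.
  obtain ⟨n₁, hn₁⟩ := exists_nat_gt ((1 + δ / 4) * F / (δ / 4))
  rw [div_lt_iff₀ (by positivity)] at hn₁
  refine ⟨max (max (M + R) n₁) (F + 1), fun n hn hne w₀ w hw₀ hw₀1 hw₀f hw hopt => ?_⟩
  have hnM : M + R ≤ n := le_trans (le_trans (le_max_left _ _) (le_max_left _ _)) hn
  have hnn₁ : n₁ ≤ n := le_trans (le_trans (le_max_right _ _) (le_max_left _ _)) hn
  have hnF : F + 1 ≤ n := le_trans (le_max_right _ _) hn
  set p := committee n E (basePrecision ν) r with hpdef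
  have hpb : ∀ k, 1 / 2 < p k ∧ p k < 1 := committee_bounds hν hr
  have hp0 : ∀ k, 0 ≤ p k := fun k => by linarith [(hpb k).1]
  have hp1 : ∀ k, p k ≤ 1 := fun k => (hpb k).2.le
  -- upper bound for the candidate
  have hsum : ∀ v : Fin n ⊕ Fin E → ℕ, ∑ k, v k = ∑ j, v (.inl j) + ∑ i, v (.inr i) :=
    fun v => Fintype.sum_sum_type v
  set S : (Fin n ⊕ Fin E → ℕ) → Finset (Fin n ⊕ Fin E) := fun v =>
    (Finset.univ.filter fun j : Fin n => v (.inl j) = 1).map Function.Embedding.inl with hS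
  have hSmem : ∀ v, ∀ k ∉ (S v)ᶜ, p k = basePrecision ν ∧ v k = 1 := by
    intro v k hk
    rw [Finset.notMem_compl] at hk
    obtain ⟨j, hj, rfl⟩ := Finset.mem_map.1 hk
    exact ⟨rfl, (Finset.mem_filter.1 hj).2⟩
  have hScard : ∀ v, (S v).card = (Finset.univ.filter fun j : Fin n => v (.inl j) = 1).card :=
    fun v => Finset.card_map _
  have hm' : (S w₀).card + F = n + E := by
    rw [← hw₀, hsum, hF, hScard, Finset.card_filter]
    congr 1
    · refine Finset.sum_congr rfl fun j _ => ?_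
      have := hw₀1 j
      split_ifs <;> omega
    · exact Finset.sum_congr rfl fun i _ => (hw₀f i).symm
  set m' := (S w₀).card with hm'def
  have hθ₀ : c ^ (n + E) * ∏ k, expWeight ν (p k) (w₀ k) = Γ := by
    rw [← hw₀, pow_mul_prod_expWeight, Fintype.prod_sum_type, hΓdef]
    have h1 : ∏ j, voterLoss ν (p (.inl j)) (w₀ (.inl j)) = 1 := by
      refine Finset.prod_eq_one fun j _ => ?_
      have h2 : p (.inl j) = basePrecision ν := rfl
      rw [h2]
      rcases Nat.le_one_iff_eq_zero_or_eq_one.1 (hw₀1 j) with h | h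
      · rw [h, voterLoss_base_zero]
      · rw [h, voterLoss_base_one hν]
    rw [h1, one_mul]
    exact Finset.prod_congr rfl fun i _ => by rw [hw₀f i]; rfl
  have hcN : 0 < c ^ (n + E) := by positivity
  have hup : lossProb p w₀ ≤ centralProb m' * ((ν - ν⁻¹)⁻¹ * Γ / c ^ (n + E)) := by
    have h1 := lossProb_le hν hp0 hp1 (w := w₀) (by rw [hw₀]; exact hne.add_odd hE) (S w₀)ᶜ
      (hSmem w₀)
    rw [compl_compl] at h1
    refine h1.trans (le_of_eq ?_)
    rw [← hθ₀, mul_left_comm, mul_div_cancel_left₀ _ hcN.ne', ← mul_assoc]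
  have hm'n : m' ≤ n := by omega
  -- the active nonexperts
  set Y : Finset (Fin n ⊕ Fin E) :=
    (Finset.univ.filter fun j : Fin n => w (.inl j) ≠ 0).map Function.Embedding.inl with hY
  set X : Finset (Fin n ⊕ Fin E) := Finset.univ.map Function.Embedding.inr with hX
  have hYcard : Y.card = (Finset.univ.filter fun j : Fin n => w (.inl j) ≠ 0).card :=
    Finset.card_map _
  by_cases hcase : Y.card + (K + F) ≤ n + E
  · have h1 := lossProb_ge_of_active hν (p := p) (fun k => (hpb k).1.le) hp1 (w := w) X Y
      (by
        rw [Finset.disjoint_left]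
        intro k hk hk'
        obtain ⟨i, _, rfl⟩ := Finset.mem_map.1 hk
        obtain ⟨j, _, h⟩ := Finset.mem_map.1 hk'
        cases h)
      (by
        intro k hk
        rw [Finset.mem_union, not_or] at hk
        rcases k with j | i
        · by_contra h
          exact hk.2 (Finset.mem_map.2 ⟨j, by simp [h], rfl⟩)
        · exact absurd (Finset.mem_map.2 ⟨i, Finset.mem_univ _, rfl⟩) hk.1)
      (by
        intro k hk
        obtain ⟨j, _, rfl⟩ := Finset.mem_map.1 hk
        rfl)
    have h2 : ∏ k ∈ X, (1 - p k) = ∏ i, (1 - r i) := by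
      rw [hX, Finset.prod_map]; rfl
    rw [h2, ← hcdef, ← hc₀def] at h1
    refine lt_of_le_of_lt hup (lt_of_lt_of_le ?_ h1)
    have h3 : centralProb m' ≤ centralProb Y.card := centralProb_antitone (by omega)
    have h4 := centralProb_pos m'
    have h5 : (ν - ν⁻¹)⁻¹ * Γ / c ^ (n + E) < c₀ * (c ^ Y.card)⁻¹ := by
      rw [div_lt_iff₀ hcN]
      have h6 : c ^ K ≤ (c ^ Y.card)⁻¹ * c ^ (n + E) := by
        rw [← div_eq_inv_mul, le_div_iff₀ (by positivity), ← pow_add]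
        exact pow_le_pow_right₀ hc.le (by omega)
      calc (ν - ν⁻¹)⁻¹ * Γ < c ^ K * c₀ := hK
        _ ≤ ((c ^ Y.card)⁻¹ * c ^ (n + E)) * c₀ := by gcongr
        _ = _ := by ring
    calc centralProb m' * ((ν - ν⁻¹)⁻¹ * Γ / c ^ (n + E))
        < centralProb m' * (c₀ * (c ^ Y.card)⁻¹) := by gcongr
      _ ≤ centralProb Y.card * (c₀ * (c ^ Y.card)⁻¹) := by gcongr
      _ = _ := by ring
  · push Not at hcase
    have hSw : (S w).card + ∑ k ∈ (S w)ᶜ, w k ≤ n + E := by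
      have h1 : ∑ k ∈ S w, w k = (S w).card := by
        rw [Finset.card_eq_sum_ones]
        exact Finset.sum_congr rfl fun k hk => (hSmem w k (by rwa [Finset.notMem_compl])).2
      rw [← h1, Finset.sum_add_sum_compl]; exact hw
    -- An active nonexpert casts either one vote or at least two. As the total is at most n+E,
    -- having few inactive nonexperts forces all but fewer than R votes to be cast by one-vote
    -- nonexperts.
    have hYS : 2 * Y.card ≤ (S w).card + ∑ k, w k := by
      rw [hsum, hYcard, hScard, Finset.card_filter, Finset.card_filter, Finset.mul_sum, ← add_assoc,
        ← Finset.sum_add_distrib]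
      refine le_trans (Finset.sum_le_sum fun j _ => ?_) (Nat.le_add_right _ _)
      split_ifs <;> omega
    have hSn : (S w).card ≤ n := by
      rw [hScard]; exact (Finset.card_le_univ _).trans (by simp)
    have h1 := hM hp0 hp1 (w := w) (S w)ᶜ (hSmem w) (by rw [compl_compl]; omega) (by omega)
    rw [compl_compl] at h1
    have hge := prod_voterLoss_ge hν hr0 hr1 hmin hw hopt hδ hδc (by
      intro i hi
      have hwR : w (.inr i) ≤ R := by
        have : w (.inr i) ≤ ∑ k ∈ (S w)ᶜ, w k := by
          refine Finset.single_le_sum (f := w) (fun _ _ => Nat.zero_le _) ?_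
          rw [Finset.mem_compl]
          intro h
          obtain ⟨j, _, h⟩ := Finset.mem_map.1 h
          cases h
        omega
      have h2 := hgap₀ (i, w (.inr i)) (by simp; omega) hi
      refine le_trans ?_ h2
      have := voterLoss_pos hν (hr0 i) (hr1 i) (f i)
      have h3 : δ ≤ δ₀ := min_le_left _ _
      gcongr)
    rw [← hcdef, ← hpdef, ← hΓdef] at hge
    have hge' : (1 + δ) * Γ / c ^ (n + E) ≤ ∏ k, expWeight ν (p k) (w k) := by
      rw [div_le_iff₀ hcN, mul_comm _ (c ^ (n + E))]; exact hge
    refine lt_of_le_of_lt hup (lt_of_lt_of_le ?_ h1)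
    have ha : centralProb n ≤ centralProb (S w).card := centralProb_antitone hSn
    have hb : centralProb m' ≤ (1 + δ / 4) * centralProb n := by
      have h2 : (m' : ℝ) * centralProb m' ≤ n * centralProb n := monotone_mul_centralProb hm'n
      have h3 : (n : ℝ) ≤ (1 + δ / 4) * m' := by
        have e1 : (m' : ℝ) + F = n + E := by exact_mod_cast hm'
        have e2 : (n₁ : ℝ) ≤ n := by exact_mod_cast hnn₁
        have e3 : (0 : ℝ) ≤ E := by positivity
        nlinarith
      have h4 : (0 : ℝ) < m' := by exact_mod_cast (by omega : 0 < m')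
      have h5 := centralProb_pos n
      have h6 : (m' : ℝ) * centralProb m' ≤ m' * ((1 + δ / 4) * centralProb n) := by nlinarith
      exact le_of_mul_le_mul_left h6 h4
    have hn0 := centralProb_pos n
    have hκ' : 0 < (ν - ν⁻¹)⁻¹ := by positivity
    set D := (ν - ν⁻¹)⁻¹ * Γ / c ^ (n + E) with hD
    have hD0 : 0 < D := by positivity
    have h8 : 1 + δ / 4 < (1 - δ / 4) * (1 + δ) := by nlinarith
    have h9 : 0 < centralProb n * D := mul_pos hn0 hD0
    calc centralProb m' * D ≤ (1 + δ / 4) * centralProb n * D :=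
          mul_le_mul_of_nonneg_right hb hD0.le
      _ = (1 + δ / 4) * (centralProb n * D) := mul_assoc _ _ _
      _ < (1 - δ / 4) * (1 + δ) * (centralProb n * D) := mul_lt_mul_of_pos_right h8 h9
      _ = (1 - δ / 4) * (centralProb n * (ν - ν⁻¹)⁻¹ * ((1 + δ) * Γ / c ^ (n + E))) := by
          rw [hD]; ring
      _ ≤ (1 - δ / 4) * (centralProb (S w).card * (ν - ν⁻¹)⁻¹ *
            ∏ k, expWeight ν (p k) (w k)) := by
          refine mul_le_mul_of_nonneg_left ?_ (by linarith)
          have h7 := centralProb_pos (S w).card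
          exact mul_le_mul (mul_le_mul_of_nonneg_right ha hκ'.le) hge' (by positivity)
            (by positivity)

end

/-! ### Exact comparison of limit-optimal weights -/

lemma lossProb_committee {n E : ℕ} {q : ℝ} {r : Fin E → ℝ} {w : Fin n ⊕ Fin E → ℕ}
    (hw : ∀ j, w (.inl j) ≤ 1) {m : ℕ} (hm : m + ∑ i, w (.inr i) = ∑ k, w k) :
    lossProb (committee n E q r) w =
      lossFun (voterPoly q 1 ^ m * ∏ i, voterPoly (r i) (w (.inr i))) := by
  have h1 : m = ∑ j, w (.inl j) := by
    have := Fintype.sum_sum_type w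
    omega
  unfold lossProb
  rw [Fintype.prod_sum_type, h1, ← Finset.prod_pow_eq_pow_sum]
  congr 2
  refine Finset.prod_congr rfl fun j _ => ?_
  rcases Nat.le_one_iff_eq_zero_or_eq_one.1 (hw j) with h | h
  · rw [h, voterPoly_zero, pow_zero]
  · rw [h, pow_one]; rfl

variable {ν : ℝ}

/-- Raising the lead by two changes the outcome only when exactly j of the m voters are wrong, where
the total lead passes from -1 to 1. -/
lemma binomLoss_sub (m j : ℕ) (hj : j ≤ m) :
    binomLoss ν m (2 * j + 1 - m) - binomLoss ν m (2 * j - 1 - m) =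
      -((m.choose j : ℝ) * ν ^ ((m : ℤ) - 2 * j) / (ν + ν⁻¹) ^ m) := by
  unfold binomLoss
  rw [← Finset.sum_sub_distrib, Finset.sum_eq_single j]
  · rw [lossAt_of_pos (by omega), lossAt_of_neg (by omega)]; ring
  · intro i _ hi
    have : lossAt (2 * (j : ℤ) + 1 - m + m - 2 * i) = lossAt (2 * (j : ℤ) - 1 - m + m - 2 * i) := by
      rcases lt_or_gt_of_ne hi with h | h
      · rw [lossAt_of_pos (by omega), lossAt_of_pos (by omega)]
      · rw [lossAt_of_neg (by omega), lossAt_of_neg (by omega)]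
    rw [this, sub_self]
  · intro h; exact absurd (Finset.mem_range.2 (Nat.lt_succ_of_le hj)) h

/-- With an integer optimal weight `a + 1`, a single expert may as well have weight `a`. -/
lemma lossFun_tie (hν : 1 < ν) {p : ℝ} (a b : ℕ) (hp : (1 - p) * (ν ^ 2) ^ (a + 1) = p) :
    lossFun (voterPoly (basePrecision ν) 1 ^ (a + 2 * b) * voterPoly p (a + 1)) =
      lossFun (voterPoly (basePrecision ν) 1 ^ (a + 2 * b + 1) * voterPoly p a) := by
  have h0 : ν ≠ 0 := by positivity
  set q := basePrecision ν with hq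
  set m := a + 2 * b with hm
  have hB : voterPoly q 1 = .single 1 q + .single (-1) (1 - q) := rfl
  have e1 : voterPoly q 1 ^ m * voterPoly p (a + 1) =
      .single ((a : ℤ) + 1) p * voterPoly q 1 ^ m +
        .single (-((a : ℤ) + 1)) (1 - p) * voterPoly q 1 ^ m := by
    rw [voterPoly.eq_1 p]; push_cast; ring
  have e2 : voterPoly q 1 ^ (m + 1) * voterPoly p a =
      .single ((a : ℤ) + 1) (p * q) * voterPoly q 1 ^ m +
      .single ((a : ℤ) + -1) (p * (1 - q)) * voterPoly q 1 ^ m +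
      .single (-(a : ℤ) + 1) ((1 - p) * q) * voterPoly q 1 ^ m +
      .single (-(a : ℤ) + -1) ((1 - p) * (1 - q)) * voterPoly q 1 ^ m := by
    rw [pow_succ, mul_assoc, mul_comm, ← add_mul, ← add_mul, ← add_mul]
    congr 1
    rw [hB, voterPoly, mul_add, add_mul, add_mul]
    simp only [AddMonoidAlgebra.single_mul_single]
    rw [add_comm 1 (a : ℤ), add_comm (-1) (a : ℤ), add_comm 1 (-(a : ℤ)),
      add_comm (-1) (-(a : ℤ)), mul_comm q p, mul_comm (1 - q) p, mul_comm q (1 - p),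
      mul_comm (1 - q) (1 - p)]
    abel
  rw [e1, e2]
  simp only [map_add, hq, lossFun_single_mul_pow hν]
  rw [← hq]
  have d1 := binomLoss_sub (ν := ν) m (a + b) (by omega)
  have d2 := binomLoss_sub (ν := ν) m b (by omega)
  have c1 : m.choose (a + b) = m.choose b := Nat.choose_symm_of_eq_add (by omega)
  rw [show 2 * ((a + b : ℕ) : ℤ) + 1 - m = a + 1 by rw [hm]; push_cast; ring,
    show 2 * ((a + b : ℕ) : ℤ) - 1 - m = a + -1 by rw [hm]; push_cast; ring,
    show (m : ℤ) - 2 * ((a + b : ℕ) : ℤ) = -(a : ℤ) by rw [hm]; push_cast; ring, c1] at d1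
  rw [show 2 * (b : ℤ) + 1 - m = -a + 1 by rw [hm]; push_cast; ring,
    show 2 * (b : ℤ) - 1 - m = -a + -1 by rw [hm]; push_cast; ring,
    show (m : ℤ) - 2 * (b : ℤ) = a by rw [hm]; push_cast; ring] at d2
  rw [neg_add]
  have hq2 : q = (1 - q) * ν ^ 2 := basePrecision_eq hν
  set u := (m.choose b : ℝ) / (ν + ν⁻¹) ^ m with hu
  have d1' : binomLoss ν m (a + 1) - binomLoss ν m (a + -1) = -(u * (ν ^ a)⁻¹) := by
    rw [d1, zpow_neg, zpow_natCast, hu]; ring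
  have d2' : binomLoss ν m (-a + 1) - binomLoss ν m (-a + -1) = -(u * ν ^ a) := by
    rw [d2, zpow_natCast, hu]; ring
  have hx : ν ^ a ≠ 0 := pow_ne_zero _ h0
  -- Moving one nonexpert's vote to the expert matters only when the two disagree and the other
  -- nonexperts offset the expert's a votes. The gain when the expert is right and the loss when she
  -- is wrong balance precisely because her odds are ν^(2(a+1)).
  have key : p * (1 - q) * (ν ^ a)⁻¹ = (1 - p) * q * ν ^ a := by
    rw [← div_eq_mul_inv, div_eq_iff hx]
    have h1 : (ν ^ 2) ^ (a + 1) = ν ^ a * ν ^ a * ν ^ 2 := by ring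
    rw [h1] at hp
    calc p * (1 - q) = (1 - p) * (ν ^ a * ν ^ a * ν ^ 2) * (1 - q) := by rw [hp]
      _ = (1 - p) * ((1 - q) * ν ^ 2) * ν ^ a * ν ^ a := by ring
      _ = _ := by rw [← hq2]
  linear_combination p * (1 - q) * d1' - (1 - p) * q * d2' - u * key

/-! ### Neutral profiles as weight vectors -/

section

variable {ι : Type}

/-- Under the neutral profile `σ`, the vote of `i` is eventually cast by the sincere voter `k`. -/
inductive EndsAt (σ : Profile ι) : ι → ι → Prop
  | sincere {k : ι} (h : Sincere (σ k)) : EndsAt σ k k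
  | delegate {i j k : ι} (h : DelegatesTo (σ i) j) (hj : EndsAt σ j k) : EndsAt σ i k

lemma Sincere.not_delegatesTo {τ : Strategy ι} (h : Sincere τ) (j : ι) : ¬ DelegatesTo τ j := by
  intro h'
  have := (h true).symm.trans (h' true)
  cases this

lemma DelegatesTo.unique {τ : Strategy ι} {j j' : ι} (h : DelegatesTo τ j)
    (h' : DelegatesTo τ j') : j = j' :=
  Action.delegate.inj ((h true).symm.trans (h' true))

lemma EndsAt.unique {σ : Profile ι} {i k k' : ι} (h : EndsAt σ i k) (h' : EndsAt σ i k') :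
    k = k' := by
  induction h with
  | sincere h =>
    cases h' with
    | sincere => rfl
    | delegate hd _ => exact absurd hd (h.not_delegatesTo _)
  | delegate hd _ ih =>
    cases h' with
    | sincere h => exact absurd hd (h.not_delegatesTo _)
    | delegate hd' hj' => exact ih (hd.unique hd' ▸ hj')

lemma EndsAt.sincere_right {σ : Profile ι} {i k : ι} (h : EndsAt σ i k) : Sincere (σ k) := by
  induction h with
  | sincere h => exact h
  | delegate _ _ ih => exact ih

lemma castFor_iff_endsAt {σ : Profile ι} (hσ : Neutral σ) (s : ι → Bool) (i : ι) (x : Bool) :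
    CastFor (fun i => σ i (s i)) i x ↔ ∃ k, EndsAt σ i k ∧ s k = x := by
  constructor
  · intro h
    induction h with
    | @vote i x h =>
      rcases hσ i with h1 | h1 | ⟨j, h1⟩
      · refine ⟨i, .sincere h1, ?_⟩
        exact (Action.vote.inj (h.symm.trans (h1 (s i)))).symm
      · simp [h1 (s i)] at h
      · simp [h1 (s i)] at h
    | @delegate i j x h _ ih =>
      obtain ⟨k, hk, hx⟩ := ih
      refine ⟨k, .delegate ?_ hk, hx⟩
      rcases hσ i with h1 | h1 | ⟨j', h1⟩
      · simp [h1 (s i)] at h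
      · simp [h1 (s i)] at h
      · have : j' = j := by simpa [h1 (s i)] using h
        exact this ▸ h1
  · rintro ⟨k, hk, rfl⟩
    induction hk with
    | sincere h => exact .vote (h _)
    | delegate h _ ih => exact .delegate (h _) ih

variable [Fintype ι]

open Classical in
/-- The number of votes cast by voter `k` under a neutral profile. -/
noncomputable def weight (σ : Profile ι) (k : ι) : ℕ :=
  (Finset.univ.filter fun i => EndsAt σ i k).card

lemma weight_pos {σ : Profile ι} {k : ι} : 0 < weight σ k ↔ Sincere (σ k) := by
  classical
  unfold weight
  rw [Finset.card_pos]
  constructor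
  · rintro ⟨i, hi⟩
    exact (Finset.mem_filter.1 hi).2.sincere_right
  · intro h
    exact ⟨k, by simpa using EndsAt.sincere h⟩

-- A vote ends at no more than one voter, so nothing is counted twice; votes reaching an abstainer
-- or a cycle are counted nowhere.
open Classical in
lemma sum_weight (σ : Profile ι) (A : Finset ι) :
    ∑ k ∈ A, weight σ k = (Finset.univ.filter fun i => ∃ k ∈ A, EndsAt σ i k).card := by
  unfold weight
  rw [← Finset.card_biUnion]
  · congr 1
    ext i; simp
  · intro k _ k' _ hne
    rw [Function.onFun, Finset.disjoint_left]
    intro i hi hi'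
    exact hne ((Finset.mem_filter.1 hi).2.unique (Finset.mem_filter.1 hi').2)

lemma sum_weight_le (σ : Profile ι) : ∑ k, weight σ k ≤ Fintype.card ι := by
  classical
  rw [sum_weight]; exact Finset.card_le_univ _

lemma exists_endsAt_of_sum_weight {σ : Profile ι} (h : ∑ k, weight σ k = Fintype.card ι) (i : ι) :
    ∃ k, EndsAt σ i k := by
  classical
  rw [sum_weight, Finset.card_eq_iff_eq_univ] at h
  have := h ▸ Finset.mem_univ i
  simpa using this

lemma tally_eq_sum_weight {σ : Profile ι} (hσ : Neutral σ) (s : ι → Bool) (x : Bool) :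
    tally (fun i => σ i (s i)) x = ∑ k with s k = x, weight σ k := by
  classical
  rw [sum_weight]
  unfold tally
  congr 1
  ext i
  simp only [Finset.mem_filter, Finset.mem_univ, true_and, castFor_iff_endsAt hσ]
  constructor
  · rintro ⟨k, h1, h2⟩; exact ⟨k, h2, h1⟩
  · rintro ⟨k, h1, h2⟩; exact ⟨k, h2, h1⟩

lemma winProb_eq (α : ι → Action ι) (x : Bool) :
    winProb α x = 1 - lossAt ((tally α x : ℤ) - tally α (!x)) := by
  unfold winProb lossAt
  rcases lt_trichotomy (tally α (!x)) (tally α x) with h | h | h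
  · have h1 : ¬ ((tally α x : ℤ) - tally α (!x) < 0) := by omega
    have h2 : ¬ ((tally α x : ℤ) - tally α (!x) = 0) := by omega
    rw [if_pos h, if_neg h1, if_neg h2, sub_zero]
  · have h1 : ¬ ((tally α x : ℤ) - tally α (!x) < 0) := by omega
    have h2 : ((tally α x : ℤ) - tally α (!x) = 0) := by omega
    rw [if_neg (by omega), if_pos h.symm, if_neg h1, if_pos h2]; norm_num
  · have h1 : ((tally α x : ℤ) - tally α (!x) < 0) := by omega
    rw [if_neg (by omega), if_neg (by omega), if_pos h1, sub_self]

variable [DecidableEq ι]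

/-- Reindexing signal realizations by the set of voters with the correct signal. -/
lemma sum_signalProb_mul (p : ι → ℝ) (ω : Bool) (g : Finset ι → ℝ) :
    ∑ s : ι → Bool, signalProb p ω s * g (Finset.univ.filter fun k => s k = ω) =
      ∑ t : Finset ι, setProb p Finset.univ t * g t := by
  refine Finset.sum_nbij' (fun s => Finset.univ.filter fun k => s k = ω)
    (fun t k => if k ∈ t then ω else !ω) ?_ ?_ ?_ ?_ ?_
  · intro s _; simp
  · intro t _; simp
  · intro s _
    funext k
    by_cases h : s k = ω
    · simp [h]
    · simp only [Finset.mem_filter, Finset.mem_univ, true_and, h, if_false]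
      exact (Bool.eq_not.2 h).symm
  · intro t _
    ext k
    by_cases h : k ∈ t <;> simp [h]
  · intro s _
    congr 1
    unfold signalProb setProb
    rw [Finset.prod_ite]
    congr 1
    refine Finset.prod_congr ?_ fun _ _ => rfl
    ext k; simp

lemma sum_setProb (p : ι → ℝ) : ∑ t : Finset ι, setProb p Finset.univ t = 1 := by
  unfold setProb
  rw [← Finset.powerset_univ, ← Finset.prod_add]
  simp

lemma sum_signalProb (p : ι → ℝ) (ω : Bool) : ∑ s : ι → Bool, signalProb p ω s = 1 := by
  rw [← sum_setProb p]
  simpa using sum_signalProb_mul p ω fun _ => 1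

/-- In either state the tally of each alternative is the total weight of the sincere voters with
that signal, so the lead depends only on who is right and both states give the same loss. -/
theorem utility_eq_one_sub_lossProb (p : ι → ℝ) {σ : Profile ι} (hσ : Neutral σ) :
    utility p σ = 1 - lossProb p (weight σ) := by
  have h : ∀ ω : Bool, ∑ s : ι → Bool, signalProb p ω s * winProb (fun i => σ i (s i)) ω =
      1 - lossProb p (weight σ) := by
    intro ω
    rw [lossProb_eq_sum p (weight σ) Finset.univ (by simp), Finset.powerset_univ, ← sum_setProb p,
      ← Finset.sum_sub_distrib]
    have h1 : ∀ t : Finset ι, setProb p Finset.univ t - setProb p Finset.univ t *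
        lossAt (lead (weight σ) Finset.univ t) = setProb p Finset.univ t *
        (1 - lossAt (lead (weight σ) Finset.univ t)) := fun t => by ring
    simp only [h1]
    rw [← sum_signalProb_mul p ω fun t => 1 - lossAt (lead (weight σ) Finset.univ t)]
    refine Finset.sum_congr rfl fun s _ => ?_
    rw [winProb_eq, tally_eq_sum_weight hσ, tally_eq_sum_weight hσ]
    congr 3
    unfold lead
    push_cast
    congr 1
    refine Finset.sum_congr ?_ fun _ _ => rfl
    ext k; simp [Bool.eq_not]
  unfold utility
  rw [Fintype.sum_bool, h, h]
  ring

end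

/-! ### Symmetry and monotonicity of the voting rule -/

section Actions

variable {ι : Type}

lemma castFor_of_vote {α : ι → Action ι} {i : ι} {y : Bool} (h : α i = .vote y) (x : Bool) :
    CastFor α i x ↔ y = x := by
  constructor
  · intro hc
    cases hc with
    | vote h' => exact Action.vote.inj (h.symm.trans h')
    | delegate h' _ => rw [h] at h'; cases h'
  · rintro rfl; exact .vote h

lemma castFor_of_abstain {α : ι → Action ι} {i : ι} (h : α i = .abstain) (x : Bool) :
    ¬ CastFor α i x := by
  intro hc
  cases hc with
  | vote h' => rw [h] at h'; cases h'
  | delegate h' _ => rw [h] at h'; cases h'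

lemma castFor_of_delegate {α : ι → Action ι} {i j : ι} (h : α i = .delegate j) (x : Bool) :
    CastFor α i x ↔ CastFor α j x := by
  constructor
  · intro hc
    cases hc with
    | vote h' => rw [h] at h'; cases h'
    | delegate h' hj => exact (Action.delegate.inj (h.symm.trans h')) ▸ hj
  · intro hj; exact .delegate h hj

/-- Exchange the two alternatives. -/
def Action.flip : Action ι → Action ι
  | .vote x => .vote (!x)
  | .abstain => .abstain
  | .delegate j => .delegate j

lemma Action.flip_flip (a : Action ι) : a.flip.flip = a := by
  cases a <;> simp [Action.flip]

lemma CastFor.flip {α : ι → Action ι} {i : ι} {x : Bool} (h : CastFor α i x) :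
    CastFor (fun k => (α k).flip) i (!x) := by
  induction h with
  | vote h => exact .vote (by rw [h]; rfl)
  | delegate h _ ih => exact .delegate (by rw [h]; rfl) ih

lemma castFor_flip_iff (α : ι → Action ι) (i : ι) (x : Bool) :
    CastFor (fun k => (α k).flip) i x ↔ CastFor α i (!x) := by
  constructor
  · intro h
    simpa [Action.flip_flip] using h.flip
  · intro h
    simpa using h.flip

/-- A delegation chain leading to x either avoids i or passes through i; in the second case it now
stops there with a vote for x. -/
lemma CastFor.update_vote [DecidableEq ι] {α : ι → Action ι} {i k : ι} {a : Action ι} {x : Bool}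
    (h : CastFor (Function.update α i a) k x) :
    CastFor (Function.update α i (.vote x)) k x := by
  induction h with
  | @vote k x h =>
    by_cases hk : k = i
    · subst hk; exact .vote (by simp)
    · rw [Function.update_of_ne hk] at h
      exact .vote (by rwa [Function.update_of_ne hk])
  | @delegate k j x h _ ih =>
    by_cases hk : k = i
    · subst hk; exact .vote (by simp)
    · rw [Function.update_of_ne hk] at h
      exact .delegate (by rwa [Function.update_of_ne hk]) ih

variable [Fintype ι]

lemma tally_flip (α : ι → Action ι) (x : Bool) :
    tally (fun k => (α k).flip) x = tally α (!x) := by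
  unfold tally
  congr 1
  ext i
  simp only [Finset.mem_filter, Finset.mem_univ, true_and, castFor_flip_iff]

lemma winProb_flip (α : ι → Action ι) (x : Bool) :
    winProb (fun k => (α k).flip) x = winProb α (!x) := by
  unfold winProb
  rw [tally_flip, tally_flip]

lemma winProb_mono {α β : ι → Action ι} {x : Bool} (h1 : tally α x ≤ tally β x)
    (h2 : tally β (!x) ≤ tally α (!x)) : winProb α x ≤ winProb β x := by
  unfold winProb
  split_ifs <;> first | omega | norm_num

lemma winProb_update_vote_le [DecidableEq ι] (α : ι → Action ι) (i : ι) (x : Bool) :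
    winProb (Function.update α i (.vote (!x))) x ≤ winProb (Function.update α i (.vote x)) x := by
  classical
  refine winProb_mono (Finset.card_le_card fun k hk => ?_) (Finset.card_le_card fun k hk => ?_)
  · simp only [Finset.mem_filter, Finset.mem_univ, true_and] at hk ⊢
    exact hk.update_vote
  · simp only [Finset.mem_filter, Finset.mem_univ, true_and] at hk ⊢
    exact hk.update_vote

end Actions

/-! ### Interim utilities and the reduction of deviations -/

section Interim

variable {ι : Type} [Fintype ι] [DecidableEq ι]

/-- The expectation of a function of the signals in state `ω`. -/
noncomputable def expect (p : ι → ℝ) (ω : Bool) (g : (ι → Bool) → ℝ) : ℝ :=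
  ∑ s, signalProb p ω s * g s

/-- The probability that a voter of precision `x` has signal `b` in state `ω`. -/
noncomputable def likelihood (x : ℝ) (b ω : Bool) : ℝ := if b = ω then x else 1 - x

lemma sum_likelihood (x : ℝ) (ω : Bool) : ∑ b, likelihood x b ω = 1 := by
  rw [Fintype.sum_bool]
  cases ω <;> simp [likelihood]

lemma expect_const (p : ι → ℝ) (ω : Bool) (c : ℝ) : expect p ω (fun _ => c) = c := by
  unfold expect
  rw [← Finset.sum_mul, sum_signalProb, one_mul]

/-- Stated as a product, not a ratio, so that no likelihood need be nonzero. -/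
lemma signalProb_update (p : ι → ℝ) (ω : Bool) (s : ι → Bool) (i : ι) (b : Bool) :
    signalProb p ω (Function.update s i b) * likelihood (p i) (s i) ω =
      signalProb p ω s * likelihood (p i) b ω := by
  unfold signalProb
  rw [← Finset.mul_prod_erase _ _ (Finset.mem_univ i),
    ← Finset.mul_prod_erase _ (fun k => if s k = ω then p k else 1 - p k) (Finset.mem_univ i),
    Function.update_self]
  have : ∏ k ∈ Finset.univ.erase i, (if Function.update s i b k = ω then p k else 1 - p k) =
      ∏ k ∈ Finset.univ.erase i, (if s k = ω then p k else 1 - p k) :=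
    Finset.prod_congr rfl fun k hk => by rw [Function.update_of_ne (Finset.ne_of_mem_erase hk)]
  rw [this]
  unfold likelihood
  ring

/-- Draw an independent copy b of i's signal: exchanging b with the signal of i is a
measure-preserving involution of the pairs (b, s). -/
lemma expect_resample (p : ι → ℝ) (ω : Bool) (g : (ι → Bool) → ℝ) (i : ι) :
    expect p ω g =
      ∑ b, likelihood (p i) b ω * expect p ω fun s => g (Function.update s i b) := by
  have h1 : ∑ b, likelihood (p i) b ω * expect p ω (fun s => g (Function.update s i b)) =
      ∑ x : Bool × (ι → Bool), likelihood (p i) x.1 ω * (signalProb p ω x.2 *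
        g (Function.update x.2 i x.1)) := by
    rw [Fintype.sum_prod_type]
    unfold expect
    simp only [Finset.mul_sum]
  have h2 : expect p ω g =
      ∑ x : Bool × (ι → Bool), likelihood (p i) x.1 ω * (signalProb p ω x.2 * g x.2) := by
    rw [Fintype.sum_prod_type]
    simp only [← Finset.mul_sum]
    rw [← Finset.sum_mul, sum_likelihood, one_mul]
    rfl
  rw [h1, h2]
  refine Finset.sum_nbij' (fun x => (x.2 i, Function.update x.2 i x.1))
    (fun x => (x.2 i, Function.update x.2 i x.1)) ?_ ?_ ?_ ?_ ?_
  · intro x _; simp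
  · intro x _; simp
  · rintro ⟨b, s⟩ _; simp
  · rintro ⟨b, s⟩ _; simp
  · rintro ⟨b, s⟩ _
    have := signalProb_update p ω s i b
    simp only [Function.update_idem, Function.update_eq_self]
    linear_combination (-g s) * this

/-- The probability of electing `ω` in state `ω` when voter `i` takes action `a`. -/
noncomputable def actionUtility (p : ι → ℝ) (σ : Profile ι) (i : ι) (a : Action ι) (ω : Bool) : ℝ :=
  expect p ω fun s => winProb (Function.update (fun k => σ k (s k)) i a) ω

/-- The interim utility when voter `i` takes action `a` at signal `b`. -/
noncomputable def interimUtility (p : ι → ℝ) (σ : Profile ι) (i : ι) (a : Action ι) (b : Bool) : ℝ :=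
  ∑ ω, likelihood (p i) b ω * actionUtility p σ i a ω

lemma utility_update (p : ι → ℝ) (σ : Profile ι) (i : ι) (τ : Strategy ι) :
    utility p (Function.update σ i τ) =
      (interimUtility p σ i (τ true) true + interimUtility p σ i (τ false) false) / 2 := by
  have h : ∀ ω, ∑ s : ι → Bool, signalProb p ω s *
      winProb (fun k => Function.update σ i τ k (s k)) ω =
      ∑ b, likelihood (p i) b ω * actionUtility p σ i (τ b) ω := by
    intro ω
    have := expect_resample p ω (fun s => winProb (fun k => Function.update σ i τ k (s k)) ω) i
    refine this.trans (Finset.sum_congr rfl fun b _ => ?_)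
    unfold actionUtility
    congr 2
    funext s
    congr 1
    funext k
    by_cases hk : k = i
    · subst hk; simp
    · simp [hk]
  unfold utility interimUtility
  simp only [h, Fintype.sum_bool]
  ring

/-- Profiles in which the strategies are invariant under exchanging the alternatives. -/
def Equivariant {ι : Type} (σ : Profile ι) : Prop := ∀ k b, σ k (!b) = (σ k b).flip

omit [Fintype ι] [DecidableEq ι] in
lemma Neutral.equivariant {σ : Profile ι} (h : Neutral σ) : Equivariant σ := by
  intro k b
  rcases h k with h | h | ⟨j, h⟩
  · rw [h, h]; rfl
  · rw [h, h]; rfl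
  · rw [h, h]; rfl

lemma expect_not (p : ι → ℝ) (ω : Bool) (g : (ι → Bool) → ℝ) :
    expect p (!ω) g = expect p ω fun s => g fun k => !(s k) := by
  unfold expect
  refine Finset.sum_nbij' (fun s k => !(s k)) (fun s k => !(s k)) ?_ ?_ ?_ ?_ ?_
  · intro s _; simp
  · intro s _; simp
  · intro s _; simp
  · intro s _; simp
  · intro s _
    simp only [Bool.not_not]
    congr 1
    unfold signalProb
    refine Finset.prod_congr rfl fun k _ => ?_
    beta_reduce
    generalize s k = c
    cases ω <;> cases c <;> simp

lemma actionUtility_flip (p : ι → ℝ) {σ : Profile ι} (hσ : Equivariant σ) (i : ι) (a : Action ι)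
    (ω : Bool) : actionUtility p σ i a.flip (!ω) = actionUtility p σ i a ω := by
  unfold actionUtility
  rw [expect_not]
  congr 1
  funext s
  rw [← winProb_flip]
  congr 1
  funext k
  by_cases hk : k = i
  · subst hk; simp [Action.flip_flip]
  · simp [hk, hσ k, Action.flip_flip]

lemma interimUtility_flip (p : ι → ℝ) {σ : Profile ι} (hσ : Equivariant σ) (i : ι) (a : Action ι)
    (b : Bool) : interimUtility p σ i a.flip (!b) = interimUtility p σ i a b := by
  unfold interimUtility
  have h1 := actionUtility_flip p hσ i a true
  have h2 := actionUtility_flip p hσ i a false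
  simp only [Fintype.sum_bool]
  simp only [Bool.not_true, Bool.not_false] at h1 h2
  rw [h1, h2]
  cases b <;> simp [likelihood] <;> ring

lemma interimUtility_eq (p : ι → ℝ) (σ : Profile ι) (i : ι) (a : Action ι) (b : Bool) :
    interimUtility p σ i a b =
      p i * actionUtility p σ i a b + (1 - p i) * actionUtility p σ i a (!b) := by
  unfold interimUtility
  rw [Fintype.sum_bool]
  cases b <;> simp [likelihood]
  ring

omit [DecidableEq ι] in
lemma signalProb_nonneg {p : ι → ℝ} (h0 : ∀ k, 0 ≤ p k) (h1 : ∀ k, p k ≤ 1) (ω : Bool)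
    (s : ι → Bool) : 0 ≤ signalProb p ω s :=
  Finset.prod_nonneg fun k _ => by
    split_ifs
    · exact h0 k
    · exact sub_nonneg.2 (h1 k)

lemma actionUtility_vote_le {p : ι → ℝ} (h0 : ∀ k, 0 ≤ p k) (h1 : ∀ k, p k ≤ 1) (σ : Profile ι)
    (i : ι) (b : Bool) :
    actionUtility p σ i (.vote (!b)) b ≤ actionUtility p σ i (.vote b) b :=
  Finset.sum_le_sum fun s _ => mul_le_mul_of_nonneg_left (winProb_update_vote_le _ i b)
    (signalProb_nonneg h0 h1 b s)

lemma actionUtility_vote_not (p : ι → ℝ) {σ : Profile ι} (hσ : Equivariant σ) (i : ι) (x ω : Bool) :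
    actionUtility p σ i (.vote x) (!ω) = actionUtility p σ i (.vote (!x)) ω := by
  have := actionUtility_flip p hσ i (.vote (!x)) ω
  simpa [Action.flip] using this

/-- By symmetry the two states see the same pair of winning probabilities in opposite order. A vote
for an alternative never hurts it, and the signal is right at least half the time. -/
lemma interimUtility_vote_le {p : ι → ℝ} (h0 : ∀ k, 1 / 2 ≤ p k) (h1 : ∀ k, p k ≤ 1)
    {σ : Profile ι} (hσ : Equivariant σ) (i : ι) (b : Bool) :
    interimUtility p σ i (.vote (!b)) b ≤ interimUtility p σ i (.vote b) b := by
  rw [interimUtility_eq, interimUtility_eq, actionUtility_vote_not p hσ,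
    actionUtility_vote_not p hσ, Bool.not_not]
  have := actionUtility_vote_le (fun k => by linarith [h0 k]) h1 σ i b
  nlinarith [h0 i]

lemma utility_update_of_equivariant (p : ι → ℝ) {σ : Profile ι} (hσ : Equivariant σ) (i : ι)
    {τ : Strategy ι} (hτ : ∀ b, τ (!b) = (τ b).flip) (b : Bool) :
    utility p (Function.update σ i τ) = interimUtility p σ i (τ b) b := by
  rw [utility_update]
  have := interimUtility_flip p hσ i (τ true) true
  rw [← hτ] at this
  simp only [Bool.not_true] at this
  cases b <;> linarith

/-- Deviations need only be checked for sincere voting, abstention and delegation. -/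
lemma utility_update_le {p : ι → ℝ} (h0 : ∀ k, 1 / 2 ≤ p k) (h1 : ∀ k, p k ≤ 1)
    {σ : Profile ι} (hσ : Equivariant σ) {M : Mechanism} {i : ι} {u : ℝ}
    (hs : utility p (Function.update σ i fun b => .vote b) ≤ u)
    (ha : utility p (Function.update σ i fun _ => .abstain) ≤ u)
    (hd : ∀ j, M.Allows i (.delegate j) → utility p (Function.update σ i fun _ => .delegate j) ≤ u)
    {τ : Strategy ι} (hτ : FeasibleStrategy M i τ) : utility p (Function.update σ i τ) ≤ u := by
  -- By equivariance, one action at one signal has the interim utility of the neutral strategy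
  -- extending it, so each signal can be treated on its own.
  have key : ∀ b, interimUtility p σ i (τ b) b ≤ u := by
    intro b
    cases h : τ b with
    | vote x =>
      rw [utility_update_of_equivariant p hσ i (fun _ => rfl) b] at hs
      by_cases hx : x = b
      · rw [hx]; exact hs
      · rw [Bool.eq_not.2 hx]; exact (interimUtility_vote_le h0 h1 hσ i b).trans hs
    | abstain => rwa [utility_update_of_equivariant p hσ i (fun _ => rfl) b] at ha
    | delegate j =>
      have hj := hd j (h ▸ hτ b)
      rwa [utility_update_of_equivariant p hσ i (fun _ => rfl) b] at hj
  rw [utility_update]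
  linarith [key true, key false]

end Interim

/-! ### Strategies that are not weakly dominated -/

section Undominated

variable {ι : Type} [Fintype ι] [DecidableEq ι]

/-- Against a profile to which τ is the unique best reply, a dominating mixture must put all its
weight on τ, and then it is nowhere strictly better. -/
lemma not_weaklyDominated_of_unique {M : Mechanism} {p : ι → ℝ} {i : ι} {τ : Strategy ι}
    {σ : Profile ι} (hσ : Feasible M σ)
    (h : ∀ ρ, FeasibleStrategy M i ρ → ρ ≠ τ →
      utility p (Function.update σ i ρ) < utility p (Function.update σ i τ)) :
    ¬ WeaklyDominated M p i τ := by
  rintro ⟨F, c, hF, hc, hle, σ', _, hlt⟩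
  have hzero : ∀ ρ ∈ F, ρ ≠ τ → c ρ = 0 := by
    by_contra hne
    push Not at hne
    obtain ⟨ρ₀, hρ₀, hρτ, hcρ⟩ := hne
    have h1 : ∑ ρ ∈ F, c ρ * utility p (Function.update σ i ρ) <
        ∑ ρ ∈ F, c ρ * utility p (Function.update σ i τ) := by
      refine Finset.sum_lt_sum (fun ρ hρ => ?_) ⟨ρ₀, hρ₀, ?_⟩
      · by_cases he : ρ = τ
        · rw [he]
        · exact mul_le_mul_of_nonneg_left (h ρ (hF ρ hρ).1 he).le (hF ρ hρ).2
      · exact mul_lt_mul_of_pos_left (h ρ₀ (hF ρ₀ hρ₀).1 hρτ)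
          (lt_of_le_of_ne (hF ρ₀ hρ₀).2 (Ne.symm hcρ))
    rw [← Finset.sum_mul, hc, one_mul] at h1
    exact absurd (hle σ hσ) (not_le.2 h1)
  have h2 : ∑ ρ ∈ F, c ρ * utility p (Function.update σ' i ρ) =
      ∑ ρ ∈ F, c ρ * utility p (Function.update σ' i τ) := by
    refine Finset.sum_congr rfl fun ρ hρ => ?_
    by_cases he : ρ = τ
    · rw [he]
    · rw [hzero ρ hρ he, zero_mul, zero_mul]
  rw [h2, ← Finset.sum_mul, hc, one_mul] at hlt
  exact lt_irrefl _ hlt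

lemma not_weaklyDominated_of_interim {M : Mechanism} {p : ι → ℝ} {i : ι} {τ : Strategy ι}
    {σ : Profile ι} (hσ : Feasible M σ)
    (h : ∀ b a, M.Allows i a → a ≠ τ b → interimUtility p σ i a b < interimUtility p σ i (τ b) b) :
    ¬ WeaklyDominated M p i τ := by
  refine not_weaklyDominated_of_unique hσ fun ρ hρ hne => ?_
  rw [utility_update, utility_update]
  have hle : ∀ b, interimUtility p σ i (ρ b) b ≤ interimUtility p σ i (τ b) b := by
    intro b
    by_cases he : ρ b = τ b
    · rw [he]
    · exact (h b _ (hρ b) he).le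
  obtain ⟨b, hb⟩ := Function.ne_iff.1 hne
  have hlt := h b _ (hρ b) hb
  have h1 := hle true
  have h2 := hle false
  cases b <;> linarith

open Classical in
lemma tally_update_abstain (i : ι) (a : Action ι) (ha : a ≠ .delegate i) (x : Bool) :
    tally (Function.update (fun _ => .abstain) i a) x = if a = .vote x then 1 else 0 := by
  have hk : ∀ k ≠ i, ¬ CastFor (Function.update (fun _ => .abstain) i a) k x := fun k hk =>
    castFor_of_abstain (by simp [hk]) x
  have hi : CastFor (Function.update (fun _ => .abstain) i a) i x ↔ a = .vote x := by
    cases a with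
    | vote y => rw [castFor_of_vote (y := y) (by simp)]; simp
    | abstain => simp [castFor_of_abstain]
    | delegate j =>
      rw [castFor_of_delegate (j := j) (by simp)]
      have : j ≠ i := fun h => ha (by rw [h])
      simp [hk j this]
  unfold tally
  split_ifs with h
  · rw [Finset.card_eq_one]
    refine ⟨i, ?_⟩
    ext k
    by_cases hki : k = i
    · subst hki
      exact iff_of_true (Finset.mem_filter.2 ⟨Finset.mem_univ _, hi.2 h⟩)
        (Finset.mem_singleton_self _)
    · simp [hk k hki, hki]
  · rw [Finset.card_eq_zero, Finset.filter_eq_empty_iff]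
    intro k _
    by_cases hki : k = i
    · subst hki; rwa [hi]
    · exact hk k hki

-- When all others abstain, voter i decides alone, and voting her signal is strictly best because
-- her precision exceeds one half.
open Classical in
lemma sincere_not_weaklyDominated (M : Mechanism) {p : ι → ℝ} {i : ι} (hi : 1 / 2 < p i)
    {τ : Strategy ι} (hτ : Sincere τ) : ¬ WeaklyDominated M p i τ := by
  have hfe : Feasible M (fun (_ : ι) (_ : Bool) => (.abstain : Action ι)) := by
    intro k b
    cases M <;> simp [Mechanism.Allows]
  refine not_weaklyDominated_of_interim hfe fun b a ha hne => ?_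
  rw [hτ] at hne ⊢
  have hal : a ≠ .delegate i := by
    cases M
    · exact ha
    · exact ha i
  have hv : ∀ a : Action ι, a ≠ .delegate i → ∀ ω,
      actionUtility p (fun _ _ => .abstain) i a ω =
        if a = .vote ω then 1 else if a = .vote (!ω) then 0 else 1 / 2 := by
    intro a ha ω
    unfold actionUtility
    rw [expect_const]
    unfold winProb
    rw [tally_update_abstain i a ha, tally_update_abstain i a ha]
    cases a with
    | vote y => cases y <;> cases ω <;> simp
    | abstain => simp
    | delegate j => simp
  rw [interimUtility_eq, interimUtility_eq, hv a hal, hv a hal, hv _ (by simp), hv _ (by simp)]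
  cases a with
  | vote y => cases y <;> cases b <;> simp at hne ⊢ <;> linarith
  | abstain => simp; linarith
  | delegate j => simp; linarith

/-- The action profile in which `k` takes action `a`, `i` votes for `x`, `l` votes for `z` and
the others abstain. -/
def threeActions (k i l : ι) (a : Action ι) (x z : Bool) : ι → Action ι :=
  Function.update (Function.update (Function.update (fun _ => .abstain) l (.vote z)) i (.vote x)) k a

open Classical in
lemma tally_threeActions {k i l : ι} (hki : k ≠ i) (hkl : k ≠ l) (hil : i ≠ l) (a : Action ι)
    (x z y : Bool) : tally (threeActions k i l a x z) y =
      (if CastFor (threeActions k i l a x z) k y then 1 else 0) + ((if x = y then 1 else 0) +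
        (if z = y then 1 else 0)) := by
  have hi : CastFor (threeActions k i l a x z) i y ↔ x = y :=
    castFor_of_vote (by simp [threeActions, hki.symm]) y
  have hl : CastFor (threeActions k i l a x z) l y ↔ z = y :=
    castFor_of_vote (by simp [threeActions, hkl.symm, hil.symm]) y
  have ho : ∀ m, m ≠ k → m ≠ i → m ≠ l → ¬ CastFor (threeActions k i l a x z) m y :=
    fun m h1 h2 h3 => castFor_of_abstain (by simp [threeActions, h1, h2, h3]) y
  unfold tally
  rw [Finset.card_filter, ← Finset.sum_subset (Finset.subset_univ {k, i, l})]
  · rw [Finset.sum_insert (by simp [hki, hkl]), Finset.sum_insert (by simp [hil]),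
      Finset.sum_singleton]
    simp only [hi, hl]
  · intro m _ hm
    simp only [Finset.mem_insert, Finset.mem_singleton, not_or] at hm
    rw [if_neg (ho m hm.1 hm.2.1 hm.2.2)]

/-- How much probability is lost when `k` takes action `a` rather than delegating to `i`, where
`i` votes for `x` and `l` votes against `x`. -/
lemma winProb_threeActions {k i l : ι} (hki : k ≠ i) (hkl : k ≠ l) (hil : i ≠ l) {a : Action ι}
    (hak : a ≠ .delegate k) :
    ∃ d : Bool → ℝ, (∀ x, 0 ≤ d x) ∧ (a = .delegate i → ∀ x, d x = 0) ∧
      (a ≠ .delegate i → 0 < d true + d false) ∧ ∀ x z ω,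
        winProb (threeActions k i l a x z) ω = (if x = ω then 1 else 0) -
          if z = x then 0 else if x = ω then d x else -d x := by
  classical
  have hi : ∀ x z y, CastFor (threeActions k i l a x z) i y ↔ x = y := fun x z y =>
    castFor_of_vote (by simp [threeActions, hki.symm]) y
  have hl : ∀ x z y, CastFor (threeActions k i l a x z) l y ↔ z = y := fun x z y =>
    castFor_of_vote (by simp [threeActions, hkl.symm, hil.symm]) y
  have ho : ∀ m, m ≠ k → m ≠ i → m ≠ l → ∀ x z y, ¬ CastFor (threeActions k i l a x z) m y :=
    fun m h1 h2 h3 x z y => castFor_of_abstain (by simp [threeActions, h1, h2, h3]) y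
  have hself : ∀ x z, threeActions k i l a x z k = a := fun x z => by simp [threeActions]
  have hnull : (∀ x z y, ¬ CastFor (threeActions k i l a x z) k y) → ∀ x z ω,
        winProb (threeActions k i l a x z) ω = (if x = ω then 1 else 0) -
          if z = x then 0 else if x = ω then 1 / 2 else -(1 / 2) := by
    intro h x z ω
    unfold winProb
    rw [tally_threeActions hki hkl hil, tally_threeActions hki hkl hil]
    simp only [h, if_false]
    cases x <;> cases z <;> cases ω <;> norm_num
  cases a with
  | vote v =>
    refine ⟨fun x => if v = x then 0 else 1, fun x => by dsimp only; split_ifs <;> norm_num,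
      by simp, fun _ => by cases v <;> simp, fun x z ω => ?_⟩
    unfold winProb
    rw [tally_threeActions hki hkl hil, tally_threeActions hki hkl hil]
    simp only [castFor_of_vote (hself x z)]
    cases v <;> cases x <;> cases z <;> cases ω <;> norm_num
  | abstain =>
    exact ⟨fun _ => 1 / 2, by norm_num, by simp, by norm_num,
      hnull fun x z => castFor_of_abstain (hself x z)⟩
  | delegate j =>
    by_cases hji : j = i
    · subst hji
      refine ⟨fun _ => 0, by simp, by simp, by simp, fun x z ω => ?_⟩
      unfold winProb
      rw [tally_threeActions hki hkl hil, tally_threeActions hki hkl hil]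
      simp only [castFor_of_delegate (hself x z), hi]
      cases x <;> cases z <;> cases ω <;> norm_num
    by_cases hjl : j = l
    · subst hjl
      refine ⟨fun _ => 1, by simp, by simp [hji], by norm_num, fun x z ω => ?_⟩
      unfold winProb
      rw [tally_threeActions hki hkl hil, tally_threeActions hki hkl hil]
      simp only [castFor_of_delegate (hself x z), hl]
      cases x <;> cases z <;> cases ω <;> norm_num
    have hjk : j ≠ k := fun h => hak (by rw [h])
    refine ⟨fun _ => 1 / 2, by norm_num, by simp [hji], by norm_num, hnull fun x z y => ?_⟩
    rw [castFor_of_delegate (hself x z)]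
    exact ho j hjk hji hjl x z y

/-- The profile in which `i` is sincere, `l` votes against her signal and the others abstain. -/
def contrarianProfile (i l : ι) : Profile ι :=
  Function.update (Function.update (fun _ _ => .abstain) l fun b => .vote (!b)) i fun b => .vote b

lemma actionUtility_contrarianProfile {p : ι → ℝ} {k i l : ι} (hki : k ≠ i) (hkl : k ≠ l)
    (hil : i ≠ l) (a : Action ι) (ω : Bool) :
    actionUtility p (contrarianProfile i l) k a ω = ∑ x, likelihood (p i) x ω *
      ∑ y, likelihood (p l) y ω * winProb (threeActions k i l a x (!y)) ω := by
  unfold actionUtility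
  rw [expect_resample p ω _ i]
  refine Finset.sum_congr rfl fun x _ => ?_
  rw [expect_resample p ω _ l]
  congr 1
  refine Finset.sum_congr rfl fun y _ => ?_
  congr 1
  have : ∀ s : ι → Bool, Function.update (fun m => contrarianProfile i l m
      (Function.update (Function.update s l y) i x m)) k a = threeActions k i l a x (!y) := by
    intro s
    funext m
    unfold threeActions contrarianProfile
    by_cases h1 : m = k
    · subst h1; simp
    by_cases h2 : m = i
    · subst h2; simp [h1]
    by_cases h3 : m = l
    · subst h3; simp [h1, h2]
    simp [h1, h2, h3]
  simp only [this, expect_const]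

/-- Against `contrarianProfile`, k matters only when the votes of i and l differ, that is, when
their signals agree. Two agreeing signals outweigh k's own as p k ≤ p l, so siding with i at both
signals is strictly best, and only delegation does so whatever i votes. -/
lemma delegate_not_weaklyDominated {p : ι → ℝ} {k i l : ι} (hki : k ≠ i) (hkl : k ≠ l)
    (hil : i ≠ l) (hi : 1 / 2 < p i) (hk : 1 / 2 < p k) (hlk : p k ≤ p l) (hl : p l < 1)
    (hi1 : p i < 1) {τ : Strategy ι} (hτ : DelegatesTo τ i) :
    ¬ WeaklyDominated .liquid p k τ := by
  have hfe : Feasible .liquid (contrarianProfile i l) := by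
    intro m b
    unfold contrarianProfile Mechanism.Allows
    by_cases h2 : m = i
    · subst h2; simp
    by_cases h3 : m = l
    · subst h3; simp [h2]
    simp [h2, h3]
  refine not_weaklyDominated_of_interim hfe fun b a ha hne => ?_
  rw [hτ] at hne ⊢
  obtain ⟨d, hd0, -, hd1, hd⟩ := winProb_threeActions hki hkl hil (a := a) ha
  obtain ⟨e, -, he0, -, he⟩ := winProb_threeActions hki hkl hil (a := .delegate i)
    (by simpa using hki.symm)
  have hd1 := hd1 hne
  have he0 := he0 rfl
  -- Another action may err for only one vote of i, so both coefficients must be positive: `hA`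
  -- covers a signal of k contradicting the pair, `hB` a confirming one.
  have hx : ∀ A B : ℝ, 0 < A → 0 < B → 0 < A * d true + B * d false := by
    intro A B hA hB
    have h1 := hd0 true
    have h2 := hd0 false
    rcases h1.lt_or_eq with h | h
    · have := mul_pos hA h
      have := mul_nonneg hB.le h2
      linarith
    · rw [← h] at hd1 ⊢
      have := mul_pos hB (by linarith : 0 < d false)
      linarith
  have hA : 0 < (1 - p k) * (p i * p l) - p k * ((1 - p i) * (1 - p l)) := by
    have h1 : p k * (1 - p l) ≤ (1 - p k) * p l := by nlinarith
    have h2 : 0 < (1 - p k) * p l := mul_pos (by linarith) (by linarith)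
    nlinarith
  have hB : 0 < p k * (p i * p l) - (1 - p k) * ((1 - p i) * (1 - p l)) := by
    have h2 : 0 ≤ (1 - p i) * (1 - p l) := mul_nonneg (by linarith) (by linarith)
    have h3 : 0 < p i * p l := mul_pos (by linarith) (by linarith)
    nlinarith
  have h1 := hx _ _ hA hB
  have h2 := hx _ _ hB hA
  rw [interimUtility_eq, interimUtility_eq]
  simp only [actionUtility_contrarianProfile hki hkl hil, hd, he, he0, Fintype.sum_bool]
  cases b
  · simp [likelihood]
    linarith
  · simp [likelihood]
    linarith

end Undominated

/-! ### Existence of equilibria -/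

section Equilibria

variable {ι : Type} [Fintype ι] [DecidableEq ι]

lemma isEquilibrium_liquid_of_max {p : ι → ℝ} (h0 : ∀ k, 1 / 2 ≤ p k) (h1 : ∀ k, p k ≤ 1)
    {σ : Profile ι} (hf : Feasible .liquid σ) (hσ : Neutral σ)
    (hmax : ∀ τ, Feasible .liquid τ → Neutral τ → utility p τ ≤ utility p σ)
    (hdom : ∀ i, ¬ WeaklyDominated .liquid p i (σ i)) : IsEquilibrium .liquid p σ := by
  refine ⟨hf, fun i τ hτ => ?_, hdom⟩
  have key : ∀ ρ : Strategy ι, FeasibleStrategy .liquid i ρ →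
      (Sincere ρ ∨ (∀ s, ρ s = .abstain) ∨ ∃ j, DelegatesTo ρ j) →
      utility p (Function.update σ i ρ) ≤ utility p σ := by
    intro ρ hρ hn
    refine hmax _ (fun k => ?_) fun k => ?_
    · by_cases hk : k = i
      · subst hk; simpa using hρ
      · simpa [hk] using hf k
    · by_cases hk : k = i
      · subst hk; simpa using hn
      · simpa [hk] using hσ k
  refine utility_update_le h0 h1 hσ.equivariant (M := .liquid) ?_ ?_ (fun j hj => ?_) hτ
  · exact key _ (fun _ => by simp [Mechanism.Allows]) (Or.inl fun _ => rfl)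
  · exact key _ (fun _ => by simp [Mechanism.Allows]) (Or.inr (Or.inl fun _ => rfl))
  · exact key _ (fun _ => hj) (Or.inr (Or.inr ⟨j, fun _ => rfl⟩))

open Classical in
lemma tally_update_sincere (s : ι → Bool) (i : ι) (a : Action ι) (ha : ∀ j, a ≠ .delegate j)
    (x : Bool) : tally (Function.update (fun k => .vote (s k)) i a) x =
      (if a = .vote x then 1 else 0) + ((Finset.univ.erase i).filter fun k => s k = x).card := by
  have hk : ∀ k ≠ i, (CastFor (Function.update (fun k => .vote (s k)) i a) k x ↔ s k = x) :=
    fun k hk => castFor_of_vote (by simp [hk]) x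
  have hi : CastFor (Function.update (fun k => .vote (s k)) i a) i x ↔ a = .vote x := by
    cases a with
    | vote y => rw [castFor_of_vote (y := y) (by simp)]; simp
    | abstain => simp [castFor_of_abstain]
    | delegate j => exact absurd rfl (ha j)
  unfold tally
  rw [Finset.card_filter, ← Finset.add_sum_erase _ _ (Finset.mem_univ i), Finset.card_filter]
  simp only [hi]
  congr 1
  refine Finset.sum_congr rfl fun k hk' => ?_
  simp only [hk k (Finset.ne_of_mem_erase hk')]

/-- The other voters are even in number, so their lead is zero or at least two in size. In both
cases abstaining gives the average of the two votes, hence is no better than a sincere vote. -/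
lemma winProb_sincere_add (hodd : Odd (Fintype.card ι)) (s : ι → Bool) (i : ι) (x : Bool) :
    winProb (Function.update (fun k => .vote (s k)) i (.vote x)) x +
      winProb (Function.update (fun k => .vote (s k)) i (.vote (!x))) x =
      2 * winProb (Function.update (fun k => .vote (s k)) i .abstain) x := by
  have hcard : ((Finset.univ.erase i).filter fun k => s k = x).card +
      ((Finset.univ.erase i).filter fun k => s k = !x).card + 1 = Fintype.card ι := by
    have h1 : ((Finset.univ.erase i).filter fun k => s k = !x) =
        (Finset.univ.erase i).filter fun k => ¬ s k = x :=
      Finset.filter_congr fun k _ => by simp [Bool.eq_not]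
    rw [h1, Finset.card_filter_add_card_filter_not, Finset.card_erase_of_mem (Finset.mem_univ i),
      Finset.card_univ]
    have : 0 < Fintype.card ι := Fintype.card_pos_iff.2 ⟨i⟩
    omega
  unfold winProb
  have hv : ∀ v y, tally (Function.update (fun k => .vote (s k)) i (.vote v)) y =
      (if v = y then 1 else 0) + ((Finset.univ.erase i).filter fun k => s k = y).card :=
    fun v y => by simp [tally_update_sincere s i (.vote v) (by simp)]
  have ha : ∀ y, tally (Function.update (fun k => .vote (s k)) i .abstain) y =
      ((Finset.univ.erase i).filter fun k => s k = y).card :=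
    fun y => by simp [tally_update_sincere s i .abstain (by simp)]
  simp only [hv, ha]
  set A := ((Finset.univ.erase i).filter fun k => s k = x).card
  set B := ((Finset.univ.erase i).filter fun k => s k = !x).card
  have hAB : A = B ∨ A + 2 ≤ B ∨ B + 2 ≤ A := by
    obtain ⟨m, hm⟩ := hodd
    omega
  have e1 : (x = !x) = False := by simp
  have e2 : ((!x) = x) = False := by simp
  simp only [e1, e2, if_true, if_false, zero_add]
  rcases hAB with h | h | h
  · rw [if_pos (by omega), if_neg (by omega), if_neg (by omega), if_neg (by omega),
      if_pos (by omega)]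
    norm_num
  · rw [if_neg (by omega), if_neg (by omega), if_neg (by omega), if_neg (by omega),
      if_neg (by omega), if_neg (by omega)]
    norm_num
  · rw [if_pos (by omega), if_pos (by omega), if_pos (by omega)]
    norm_num

/-- With an odd number of voters, sincere voting by everyone is an equilibrium of direct
democracy. -/
lemma sincere_isEquilibrium_direct (hodd : Odd (Fintype.card ι)) {p : ι → ℝ}
    (h0 : ∀ k, 1 / 2 < p k) (h1 : ∀ k, p k ≤ 1) :
    IsEquilibrium .direct p (fun (_ : ι) b => .vote b) := by
  have hN : Neutral (fun (_ : ι) (b : Bool) => (.vote b : Action ι)) := fun k => Or.inl fun _ => rfl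
  have hE := hN.equivariant
  refine ⟨fun k b j => by simp, fun i τ hτ => ?_, fun i =>
    sincere_not_weaklyDominated _ (h0 i) fun _ => rfl⟩
  have hself : Function.update (fun (_ : ι) (b : Bool) => (.vote b : Action ι)) i
      (fun b => .vote b) = fun _ b => .vote b := by
    simp
  refine utility_update_le (fun k => (h0 k).le) h1 hE (M := .direct) ?_ ?_ (fun j hj => ?_) hτ
  · rw [hself]
  · conv_rhs => rw [← hself]
    rw [utility_update_of_equivariant p hE i (fun _ => rfl) true,
      utility_update_of_equivariant p hE i (fun _ => rfl) true, interimUtility_eq,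
      interimUtility_eq, actionUtility_vote_not p hE]
    have h2 := actionUtility_flip p hE i .abstain true
    have h3 := actionUtility_vote_le (p := p) (fun k => by linarith [h0 k]) h1
      (fun (_ : ι) b => .vote b) i true
    have h4 : actionUtility p (fun (_ : ι) b => .vote b) i (.vote true) true +
        actionUtility p (fun (_ : ι) b => .vote b) i (.vote (!true)) true =
        2 * actionUtility p (fun (_ : ι) b => .vote b) i .abstain true := by
      unfold actionUtility expect
      rw [← Finset.sum_add_distrib, Finset.mul_sum]
      refine Finset.sum_congr rfl fun s _ => ?_
      rw [← mul_add, winProb_sincere_add hodd]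
      ring
    simp only [Action.flip] at h2
    rw [h2]
    nlinarith [h0 i]
  · exact absurd rfl (hj j)

instance {ι : Type} [Finite ι] : Finite (Action ι) := by
  refine Finite.of_injective (fun a : Action ι => (match a with
    | .vote x => some (Sum.inl x)
    | .abstain => none
    | .delegate j => some (Sum.inr j) : Option (Bool ⊕ ι))) ?_
  intro a b h
  cases a <;> cases b <;> simp_all

lemma exists_max_utility (p : ι → ℝ) {P : Profile ι → Prop} (h : ∃ σ, P σ) :
    ∃ σ, P σ ∧ ∀ τ, P τ → utility p τ ≤ utility p σ := by
  obtain ⟨σ, hσ⟩ := h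
  obtain ⟨σ', h1, h2⟩ := Set.exists_max_image {σ | P σ} (utility p) (Set.toFinite _) ⟨σ, hσ⟩
  exact ⟨σ', h1, h2⟩

omit [DecidableEq ι] in
lemma weight_le_one_of_direct {σ : Profile ι} (hf : Feasible .direct σ) (k : ι) :
    weight σ k ≤ 1 := by
  classical
  unfold weight
  refine Finset.card_le_one.2 ?_
  have : ∀ i, EndsAt σ i k → i = k := by
    intro i h
    cases h with
    | sincere _ => rfl
    | delegate hd _ => exact absurd (hd true) (hf i true _)
  intro i hi i' hi'
  rw [this i (Finset.mem_filter.1 hi).2, this i' (Finset.mem_filter.1 hi').2]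

end Equilibria

/-! ### The delegation profile and its weights -/

section Candidate

variable {n E : ℕ}

lemma exists_assignment (d : Fin E → ℕ) (h : ∑ i, d i ≤ n) :
    ∃ g : Fin n → Option (Fin E), ∀ i, (Finset.univ.filter fun j => g j = some i).card = d i := by
  have e : Fin n ≃ (Σ i, Fin (d i)) ⊕ Fin (n - ∑ i, d i) :=
    Fintype.equivOfCardEq (by simp; omega)
  refine ⟨fun j => Sum.elim (fun x => some x.1) (fun _ => none) (e j), fun i => ?_⟩
  have hinj : Function.Injective fun a : Fin (d i) => e.symm (.inl ⟨i, a⟩) := fun a b hab => by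
    simpa using hab
  have : (Finset.univ.filter fun j => Sum.elim (fun x => some x.1) (fun _ => none) (e j) = some i) =
      (Finset.univ : Finset (Fin (d i))).map ⟨_, hinj⟩ := by
    ext j
    simp only [Finset.mem_filter, Finset.mem_univ, true_and, Finset.mem_map,
      Function.Embedding.coeFn_mk]
    constructor
    · intro hj
      rcases hx : e j with ⟨i', a⟩ | y
      · rw [hx] at hj
        simp only [Sum.elim_inl, Option.some.injEq] at hj
        subst hj
        exact ⟨a, by rw [← hx, Equiv.symm_apply_apply]⟩
      · rw [hx] at hj; simp at hj
    · rintro ⟨a, rfl⟩; simp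
  rw [this, Finset.card_map, Finset.card_univ, Fintype.card_fin]

/-- The profile in which nonexpert `j` delegates to the expert `g j`, if there is one, and all
other voters are sincere. -/
def delegationProfile (g : Fin n → Option (Fin E)) : Profile (Fin n ⊕ Fin E) :=
  Sum.elim (fun j b => (g j).elim (.vote b) fun i => .delegate (.inr i)) fun _ b => .vote b

variable (g : Fin n → Option (Fin E))

lemma delegationProfile_of_none {j : Fin n} (h : g j = none) :
    Sincere (delegationProfile g (.inl j)) := fun b => by simp [delegationProfile, h]

lemma delegationProfile_of_some {j : Fin n} {i : Fin E} (h : g j = some i) :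
    DelegatesTo (delegationProfile g (.inl j)) (.inr i) := fun b => by simp [delegationProfile, h]

lemma delegationProfile_inr (i : Fin E) : Sincere (delegationProfile g (.inr i)) :=
  fun b => by simp [delegationProfile]

lemma delegatesTo_delegationProfile {j : Fin n} {i : Fin E} :
    DelegatesTo (delegationProfile g (.inl j)) (.inr i) ↔ g j = some i := by
  refine ⟨fun h => ?_, delegationProfile_of_some g⟩
  cases hg : g j with
  | none => exact absurd h ((delegationProfile_of_none g hg).not_delegatesTo _)
  | some i' =>
    have := (delegationProfile_of_some g hg).unique h
    rw [Sum.inr.inj this]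

lemma neutral_delegationProfile : Neutral (delegationProfile g) := by
  rintro (j | i)
  · cases hg : g j with
    | none => exact Or.inl (delegationProfile_of_none g hg)
    | some i => exact Or.inr (Or.inr ⟨_, delegationProfile_of_some g hg⟩)
  · exact Or.inl (delegationProfile_inr g i)

lemma feasible_delegationProfile : Feasible .liquid (delegationProfile g) := by
  rintro (j | i) b
  · cases hg : g j with
    | none => rw [delegationProfile_of_none g hg]; simp [Mechanism.Allows]
    | some i => rw [delegationProfile_of_some g hg]; simp [Mechanism.Allows]
  · rw [delegationProfile_inr g i]; simp [Mechanism.Allows]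

lemma endsAt_delegationProfile (k : Fin n ⊕ Fin E) :
    EndsAt (delegationProfile g) k
      (Sum.elim (fun j => (g j).elim (.inl j) .inr) .inr k) := by
  rcases k with j | i
  · cases hg : g j with
    | none => simpa [hg] using EndsAt.sincere (delegationProfile_of_none g hg)
    | some i =>
      simpa [hg] using EndsAt.delegate (delegationProfile_of_some g hg)
        (.sincere (delegationProfile_inr g i))
  · exact .sincere (delegationProfile_inr g i)

lemma sum_weight_delegationProfile : ∑ k, weight (delegationProfile g) k = n + E := by
  classical
  rw [sum_weight, Finset.filter_true_of_mem, Finset.card_univ]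
  · simp
  · exact fun k _ => ⟨_, Finset.mem_univ _, endsAt_delegationProfile g k⟩

lemma weight_delegationProfile_inl (j : Fin n) : weight (delegationProfile g) (.inl j) ≤ 1 := by
  classical
  unfold weight
  have : ∀ k, EndsAt (delegationProfile g) k (.inl j) → k = .inl j := by
    intro k h
    have h' := h.unique (endsAt_delegationProfile g k)
    rcases k with j' | i
    · cases hg : g j' with
      | none => simp [hg] at h'; rw [h']
      | some i => simp [hg] at h'
    · simp at h'
  refine Finset.card_le_one.2 fun k hk k' hk' => ?_
  rw [this k (Finset.mem_filter.1 hk).2, this k' (Finset.mem_filter.1 hk').2]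

lemma weight_delegationProfile_inr (i : Fin E) : weight (delegationProfile g) (.inr i) =
    (Finset.univ.filter fun j => g j = some i).card + 1 := by
  classical
  have h : ∀ k, EndsAt (delegationProfile g) k (.inr i) ↔
      Sum.elim (fun j => (g j).elim (.inl j) .inr) .inr k = (.inr i : Fin n ⊕ Fin E) := fun k =>
    ⟨fun h => (endsAt_delegationProfile g k).unique h, fun h => h ▸ endsAt_delegationProfile g k⟩
  unfold weight
  rw [Finset.card_filter, Finset.card_filter, Fintype.sum_sum_type]
  simp only [h]
  congr 1
  · refine Finset.sum_congr rfl fun j _ => ?_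
    cases hg : g j <;> simp [hg]
  · simp

end Candidate

/-! ### Limit-optimal profiles of the committee -/

section Committee

variable {ν : ℝ} {n E : ℕ}

/-- Translates comparison of w* with an integer into the logarithm-free inequality governing the
increments of `voterLoss`. -/
lemma le_optimalWeight_iff (hν : 1 < ν) {p : ℝ} (h0 : 0 < p) (h1 : p < 1) (k : ℕ) :
    (k : ℝ) ≤ optimalWeight (basePrecision ν) p ↔ (1 - p) * (ν ^ 2) ^ k ≤ p := by
  have hν2 : 1 < ν ^ 2 := by nlinarith
  have hodds : basePrecision ν / (1 - basePrecision ν) = ν ^ 2 := by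
    rw [div_eq_iff (one_sub_basePrecision_pos hν).ne', mul_comm]
    exact basePrecision_eq hν
  have hp : 0 < 1 - p := by linarith
  unfold optimalWeight
  rw [hodds, le_div_iff₀ (Real.log_pos hν2), ← Real.log_pow,
    Real.log_le_log_iff (by positivity) (by positivity), le_div_iff₀ hp, mul_comm]

/-- What `LimitOptimal` says about the weight of an expert. -/
lemma expert_weight_eq (hν : 1 < ν) {p : ℝ} (h0 : 0 < p) (h1 : p < 1) {w : ℕ}
    (hw : voterLoss ν p w = voterLoss ν p ⌊optimalWeight (basePrecision ν) p⌋₊)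
    (hpos : 0 ≤ optimalWeight (basePrecision ν) p) :
    w = ⌊optimalWeight (basePrecision ν) p⌋₊ ∨
      (w + 1 = ⌊optimalWeight (basePrecision ν) p⌋₊ ∧
        optimalWeight (basePrecision ν) p = ((w + 1 : ℕ) : ℝ) ∧
        (1 - p) * (ν ^ 2) ^ (w + 1) = p) := by
  have hp : 0 < 1 - p := by linarith
  have hf := (le_optimalWeight_iff hν h0 h1 _).1 (Nat.floor_le hpos)
  have hf' : p < (1 - p) * (ν ^ 2) ^ (⌊optimalWeight (basePrecision ν) p⌋₊ + 1) := by
    rw [← not_le, ← le_optimalWeight_iff hν h0 h1, not_le]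
    exact_mod_cast Nat.lt_floor_add_one _
  rcases eq_of_voterLoss_eq hν h1 hf hf' hw with h | ⟨h2, h3⟩
  · exact Or.inl h
  · refine Or.inr ⟨h2, le_antisymm ?_ ?_, by rwa [h2]⟩
    · by_contra h4
      push Not at h4
      have hν2 : 1 < ν ^ 2 := by nlinarith
      have hodds : basePrecision ν / (1 - basePrecision ν) = ν ^ 2 := by
        rw [div_eq_iff (one_sub_basePrecision_pos hν).ne', mul_comm]
        exact basePrecision_eq hν
      have h5 : p / (1 - p) = (ν ^ 2) ^ (w + 1) := by rw [div_eq_iff hp.ne', mul_comm, h2, h3]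
      unfold optimalWeight at h4
      rw [hodds, h5, Real.log_pow, mul_div_cancel_right₀ _ (Real.log_pos hν2).ne'] at h4
      exact lt_irrefl _ h4
    · rw [h2]; exact Nat.floor_le hpos

lemma one_lt_optimalWeight (hν : 1 < ν) {p : ℝ} (h0 : basePrecision ν < p) (h1 : p < 1) :
    1 < optimalWeight (basePrecision ν) p := by
  have hq := basePrecision_pos hν
  have hq2 := one_sub_basePrecision_pos hν
  have hν2 : 1 < ν ^ 2 := by nlinarith
  have hodds : basePrecision ν / (1 - basePrecision ν) = ν ^ 2 := by
    rw [div_eq_iff hq2.ne', mul_comm]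
    exact basePrecision_eq hν
  have hp : 0 < 1 - p := by linarith
  unfold optimalWeight
  rw [hodds, one_lt_div (Real.log_pos hν2)]
  refine Real.log_lt_log (by positivity) ?_
  rw [← hodds, div_lt_div_iff₀ hq2 hp]
  nlinarith

lemma sum_weight_le_committee (σ : Profile (Fin n ⊕ Fin E)) : ∑ k, weight σ k ≤ n + E := by
  simpa using sum_weight_le σ

/-- In a neutral profile with limit-optimal weights no strategy is weakly dominated. -/
lemma LimitOptimal.not_weaklyDominated (hν : 1 < ν) {r : Fin E → ℝ}
    (hr : ∀ i, basePrecision ν < r i ∧ r i < 1) (hn : 3 ≤ n)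
    {σ : Profile (Fin n ⊕ Fin E)} (hf : Feasible .liquid σ) (hσ : Neutral σ)
    (hopt : LimitOptimal ν r (fun i => ⌊optimalWeight (basePrecision ν) (r i)⌋₊) (weight σ))
    (k : Fin n ⊕ Fin E) :
    ¬ WeaklyDominated .liquid (committee n E (basePrecision ν) r) k (σ k) := by
  have hpb := committee_bounds (n := n) hν hr
  rcases hσ k with h | h | ⟨m, hm⟩
  · exact sincere_not_weaklyDominated _ (hpb k).1 h
  · obtain ⟨k', hk'⟩ := exists_endsAt_of_sum_weight (σ := σ) (by simpa using hopt.1) k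
    cases hk' with
    | sincere h' => have := (h true).symm.trans (h' true); cases this
    | delegate h' _ => have := (h true).symm.trans (h' true); cases this
  · have hmk : k ≠ m := by
      rintro rfl
      exact hf k true (hm true)
    rcases k with j | i
    -- The contrarian is a third voter, again a nonexpert so that her precision is not below that of
    -- j; this is what n ≥ 3 is for.
    · obtain ⟨l, hl⟩ : ∃ l : Fin n, l ≠ j ∧ Sum.inl l ≠ m := by
        have hcard : ({j} ∪ (Finset.univ.filter fun l : Fin n => Sum.inl l = m)).card <
            (Finset.univ : Finset (Fin n)).card := by
          refine lt_of_le_of_lt (Finset.card_union_le _ _) ?_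
          have : (Finset.univ.filter fun l : Fin n => Sum.inl l = m).card ≤ 1 :=
            Finset.card_le_one.2 fun a ha b hb => Sum.inl.inj
              ((Finset.mem_filter.1 ha).2.trans (Finset.mem_filter.1 hb).2.symm)
          simp only [Finset.card_singleton, Finset.card_univ, Fintype.card_fin]
          omega
        obtain ⟨l, -, hl⟩ := Finset.exists_mem_notMem_of_card_lt_card hcard
        refine ⟨l, ?_, ?_⟩
        · rintro rfl; simp at hl
        · intro h; simp [h] at hl
      exact delegate_not_weaklyDominated hmk (l := .inl l)
        (fun h => hl.1 (Sum.inl.inj h).symm) hl.2.symm (hpb m).1 (hpb _).1 le_rfl (hpb _).2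
        (hpb m).2 hm
    · exfalso
      have h1 := one_lt_optimalWeight hν (hr i).1 (hr i).2
      have h2 : Sincere (σ (.inr i)) := by
        rw [← weight_pos]
        rcases expert_weight_eq hν ((basePrecision_pos hν).trans (hr i).1) (hr i).2 (hopt.2.2 i)
          (by linarith) with h | ⟨_, h, _⟩
        · rw [h]
          exact Nat.floor_pos.2 h1.le
        · rw [h] at h1
          have : 1 < weight σ (.inr i) + 1 := by exact_mod_cast h1
          omega
      exact h2.not_delegatesTo _ hm

/-- Under the assumptions of the first part, all limit-optimal weights are equally good. -/
lemma LimitOptimal.lossProb_eq (hν : 1 < ν) (hne : Even n) {r : Fin E → ℝ}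
    (hr : ∀ i, basePrecision ν < r i ∧ r i < 1)
    (hE : E = 1 ∨ ∀ i, ∀ k : ℤ, optimalWeight (basePrecision ν) (r i) ≠ (k : ℝ))
    (hn : 2 * ∑ i, ⌊optimalWeight (basePrecision ν) (r i)⌋₊ ≤ n)
    {w₀ w : Fin n ⊕ Fin E → ℕ} (hw₀ : ∑ k, w₀ k = n + E) (hw₀1 : ∀ j, w₀ (.inl j) ≤ 1)
    (hw₀f : ∀ i, w₀ (.inr i) = ⌊optimalWeight (basePrecision ν) (r i)⌋₊)
    (hopt : LimitOptimal ν r (fun i => ⌊optimalWeight (basePrecision ν) (r i)⌋₊) w) :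
    lossProb (committee n E (basePrecision ν) r) w =
      lossProb (committee n E (basePrecision ν) r) w₀ := by
  obtain ⟨hw, hw1, hwf⟩ := hopt
  have hcase := fun i => expert_weight_eq hν ((basePrecision_pos hν).trans (hr i).1) (hr i).2 (hwf i)
    (zero_le_one.trans (one_lt_optimalWeight hν (hr i).1 (hr i).2).le)
  have same : (∀ i, w (.inr i) = w₀ (.inr i)) →
      lossProb (committee n E (basePrecision ν) r) w =
      lossProb (committee n E (basePrecision ν) r) w₀ := by
    intro h
    have h1 : ∑ i, w (.inr i) = ∑ i, w₀ (.inr i) := Finset.sum_congr rfl fun i _ => h i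
    have h2 : ∑ j, w (.inl j) + ∑ i, w (.inr i) = ∑ k, w k := (Fintype.sum_sum_type w).symm
    rw [lossProb_committee hw1 h2,
      lossProb_committee (m := ∑ j, w (.inl j)) hw₀1 (by rw [← h1, h2, hw, hw₀])]
    simp only [h]
  rcases hE with rfl | hE
  · rcases hcase 0 with h | ⟨h2, _, h3⟩
    · refine same fun i => ?_
      rw [Subsingleton.elim i 0, h, hw₀f]
    · have h4 : w₀ (.inr 0) = w (.inr 0) + 1 := by rw [hw₀f, h2]
      have hn' : 2 * (w (.inr 0) + 1) ≤ n := by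
        rw [h2]; simpa using hn
      -- Evenness of n makes the number of casting nonexperts congruent to a modulo 2, as the exact
      -- tie requires; the lower bound on n makes b a natural number.
      obtain ⟨b, hb⟩ : ∃ b, n = w (.inr 0) + (w (.inr 0) + 2 * b) := by
        obtain ⟨c, hc⟩ := hne
        exact ⟨c - w (.inr 0), by omega⟩
      set a := w (.inr 0) with ha
      rw [lossProb_committee (m := a + 2 * b + 1) hw1 (by
          rw [hw, Fin.sum_univ_one, ← ha]; omega),
        lossProb_committee (m := a + 2 * b) hw₀1 (by
          rw [hw₀, Fin.sum_univ_one, h4]; omega)]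
      rw [Fin.prod_univ_one, Fin.prod_univ_one, ← ha, h4]
      exact (lossFun_tie hν a b h3).symm
  · refine same fun i => ?_
    rcases hcase i with h | ⟨_, h, _⟩
    · rw [h, hw₀f]
    · exact absurd h (by exact_mod_cast hE i ((w (.inr i) + 1 : ℕ) : ℤ))

end Committee

/-- The tilt ν is the square root of a nonexpert's odds, so that right and wrong signals carry
weights proportional to ν and ν⁻¹. -/
lemma exists_basePrecision_eq {q : ℝ} (hq : 1 / 2 < q) (hq' : q < 1) :
    ∃ ν, 1 < ν ∧ basePrecision ν = q := by
  have h1 : 0 < 1 - q := by linarith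
  have h2 : 1 < q / (1 - q) := by rw [one_lt_div h1]; linarith
  refine ⟨√(q / (1 - q)), Real.lt_sqrt_of_sq_lt (by simpa using h2), ?_⟩
  have h3 : 0 < √(q / (1 - q)) := Real.sqrt_pos.2 (by linarith)
  have h4 : √(q / (1 - q)) * √(q / (1 - q)) = q / (1 - q) := Real.mul_self_sqrt (by linarith)
  unfold basePrecision
  rw [div_eq_iff (by positivity)]
  have h5 : √(q / (1 - q)) * (1 - q) = q * (√(q / (1 - q)))⁻¹ := by
    rw [eq_mul_inv_iff_mul_eq₀ h3.ne', mul_right_comm, h4, div_mul_cancel₀ _ h1.ne']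
  linarith

end LiquidDemocracy

/-! ### Assembly -/

theorem mainTheorem5 (q : ℝ) (hq : 1 / 2 < q) (hq' : q < 1) (E : ℕ) (hE : Odd E)
    (r : Fin E → ℝ) (hr : ∀ i, q < r i ∧ r i < 1) :
    ∃ nbar : ℕ, ∀ n : ℕ, nbar ≤ n → Even n →
      ((E = 1 ∨ ∀ i, ∀ k : ℤ, optimalWeight q (r i) ≠ (k : ℝ)) →
        ∃ σ : Profile (Fin n ⊕ Fin E),
          IsBestNeutralEquilibrium .liquid (committee n E q r) σ ∧
          (∀ i : Fin E,
            (Set.ncard {j : Fin n | DelegatesTo (σ (Sum.inl j)) (Sum.inr i)} : ℤ) =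
              ⌊optimalWeight q (r i)⌋ - 1) ∧
          (∀ k : Fin n ⊕ Fin E,
            (¬ ∃ (j : Fin n) (i : Fin E), k = Sum.inl j ∧ DelegatesTo (σ k) (Sum.inr i)) →
              Sincere (σ k))) ∧
      ((∃ i, 2 < optimalWeight q (r i)) →
        (∃ σ, IsBestNeutralEquilibrium .liquid (committee n E q r) σ) ∧
        (∃ τ, IsBestNeutralEquilibrium .direct (committee n E q r) τ) ∧
        ∀ σ τ, IsBestNeutralEquilibrium .liquid (committee n E q r) σ →
          IsBestNeutralEquilibrium .direct (committee n E q r) τ →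
            utility (committee n E q r) τ < utility (committee n E q r) σ) := by
  obtain ⟨ν, hν, rfl⟩ := exists_basePrecision_eq hq hq'
  have hr0 : ∀ i, 0 < r i := fun i => (basePrecision_pos hν).trans (hr i).1
  have hopt1 : ∀ i, 1 < optimalWeight (basePrecision ν) (r i) := fun i =>
    one_lt_optimalWeight hν (hr i).1 (hr i).2
  set f : Fin E → ℕ := fun i => ⌊optimalWeight (basePrecision ν) (r i)⌋₊ with hf
  have hf1 : ∀ i, 1 ≤ f i := fun i => Nat.floor_pos.2 (hopt1 i).le
  have hmin : ∀ i v, voterLoss ν (r i) (f i) ≤ voterLoss ν (r i) v := fun i v =>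
    voterLoss_floor_le hν (hr i).2
      ((le_optimalWeight_iff hν (hr0 i) (hr i).2 _).1 (Nat.floor_le (by linarith [hopt1 i])))
      (by
        rw [← not_le, ← le_optimalWeight_iff hν (hr0 i) (hr i).2, not_le]
        exact_mod_cast Nat.lt_floor_add_one _) v
  obtain ⟨N, hN⟩ := exists_lossProb_lt hν hE hr hf1 hmin
  refine ⟨max N (max 3 (2 * ∑ i, f i)), fun n hn hne => ?_⟩
  have hnN : N ≤ n := (le_max_left _ _).trans hn
  have hn3 : 3 ≤ n := (le_max_left _ _).trans ((le_max_right _ _).trans hn)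
  have hnf : 2 * ∑ i, f i ≤ n := (le_max_right _ _).trans ((le_max_right _ _).trans hn)
  obtain ⟨g, hg⟩ := exists_assignment (n := n) (fun i => f i - 1)
    ((Finset.sum_le_sum fun i _ => Nat.sub_le _ _).trans (by omega))
  set p := committee n E (basePrecision ν) r with hp
  have hpb : ∀ k, 1 / 2 < p k ∧ p k < 1 := committee_bounds hν hr
  set σ₀ := delegationProfile g with hσ₀
  have hw₀ : ∑ k, weight σ₀ k = n + E := sum_weight_delegationProfile g
  have hw₀1 : ∀ j, weight σ₀ (.inl j) ≤ 1 := weight_delegationProfile_inl g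
  have hw₀f : ∀ i, weight σ₀ (.inr i) = f i := fun i => by
    rw [weight_delegationProfile_inr, hg]
    have := hf1 i
    omega
  have hlt : ∀ τ, Neutral τ → ¬ LimitOptimal ν r f (weight τ) → utility p τ < utility p σ₀ := by
    intro τ hτ hopt
    rw [utility_eq_one_sub_lossProb p hτ,
      utility_eq_one_sub_lossProb p (neutral_delegationProfile g)]
    have := hN n hnN hne (weight σ₀) (weight τ) hw₀ hw₀1 hw₀f (sum_weight_le_committee τ) hopt
    linarith
  have hbest : ∀ σ, Feasible .liquid σ → Neutral σ → LimitOptimal ν r f (weight σ) →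
      (∀ τ, Feasible .liquid τ → Neutral τ → utility p τ ≤ utility p σ) →
      IsBestNeutralEquilibrium .liquid p σ := fun σ h1 h2 h3 h4 =>
    ⟨isEquilibrium_liquid_of_max (fun k => (hpb k).1.le) (fun k => (hpb k).2.le) h1 h2 h4
      (h3.not_weaklyDominated hν hr hn3 h1 h2), h2, fun τ h5 h6 => h4 τ h5.1 h6⟩
  refine ⟨fun hcase => ⟨σ₀, hbest σ₀ (feasible_delegationProfile g) (neutral_delegationProfile g)
    ⟨hw₀, hw₀1, fun i => by rw [hw₀f]⟩ fun τ _ hτ => ?_, fun i => ?_, fun k hk => ?_⟩,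
    fun ⟨i, hi⟩ => ?_⟩
  · by_cases hopt : LimitOptimal ν r f (weight τ)
    · rw [utility_eq_one_sub_lossProb p hτ,
        utility_eq_one_sub_lossProb p (neutral_delegationProfile g),
        hopt.lossProb_eq hν hne hr hcase hnf hw₀ hw₀1 hw₀f]
    · exact (hlt τ hτ hopt).le
  · have h1 : {j : Fin n | DelegatesTo (σ₀ (.inl j)) (.inr i)} =
        ↑(Finset.univ.filter fun j => g j = some i) := by
      ext j
      simp [hσ₀, delegatesTo_delegationProfile]
    rw [h1, Set.ncard_coe_finset, hg, Nat.cast_sub (hf1 i), hf,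
      Int.natCast_floor_eq_floor (by linarith [hopt1 i])]
    rfl
  · rcases k with j | i
    · cases hgj : g j with
      | none => exact delegationProfile_of_none g hgj
      | some i => exact absurd ⟨j, i, rfl, delegationProfile_of_some g hgj⟩ hk
    · exact delegationProfile_inr g i
  -- Here w* may be an integer for several experts, so the candidate need not be optimal. A
  -- maximizer over the finitely many feasible neutral profiles is used; it must be limit optimal,
  -- since otherwise the candidate would beat it.
  · obtain ⟨σm, ⟨hm1, hm2⟩, hm3⟩ := exists_max_utility p
      (P := fun σ => Feasible .liquid σ ∧ Neutral σ)
      ⟨σ₀, feasible_delegationProfile g, neutral_delegationProfile g⟩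
    have hm₀ : utility p σ₀ ≤ utility p σm :=
      hm3 σ₀ ⟨feasible_delegationProfile g, neutral_delegationProfile g⟩
    have hm4 : IsBestNeutralEquilibrium .liquid p σm :=
      hbest σm hm1 hm2 (by
        by_contra h
        exact absurd (hlt σm hm2 h) (not_lt.2 hm₀)) fun τ h1 h2 => hm3 τ ⟨h1, h2⟩
    obtain ⟨τm, ⟨ht1, ht2⟩, ht3⟩ := exists_max_utility p
      (P := fun τ => IsEquilibrium .direct p τ ∧ Neutral τ)
      ⟨fun _ b => .vote b, sincere_isEquilibrium_direct (by simpa using hne.add_odd hE)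
        (fun k => (hpb k).1) (fun k => (hpb k).2.le), fun _ => Or.inl fun _ => rfl⟩
    refine ⟨⟨σm, hm4⟩, ⟨τm, ht1, ht2, fun τ h1 h2 => ht3 τ ⟨h1, h2⟩⟩, fun σ τ hσ hτ => ?_⟩
    refine lt_of_lt_of_le (hlt τ hτ.2.1 fun hopt => ?_) (hm₀.trans (hσ.2.2 σm hm4.1 hm4.2.1))
    -- Limit optimality would give expert i either ⌊w*⌋ ≥ 2 votes or, at an integer w* > 2, w*-1 ≥ 2
    -- votes.
    have hw := weight_le_one_of_direct hτ.1.1 (.inr i)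
    rcases expert_weight_eq hν (hr0 i) (hr i).2 (hopt.2.2 i) (by linarith) with h | ⟨_, h, _⟩
    · have h2 : 2 ≤ f i := Nat.le_floor (by exact_mod_cast hi.le)
      have h3 : weight τ (.inr i) = f i := h
      omega
    · rw [h] at hi
      have : 2 < weight τ (.inr i) + 1 := by exact_mod_cast hi
      omega
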